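/- Let $\Delta$ be a thick irreducible spherical building of rank at least $2$, with finite type set $I$. Suppose that $\Delta$ is a compact spherical building, that is, for each $i\in I$ the set $V_i$ of vertices of type $i$ carries a compact Hausdorff topology such that the set $C$ of chambers, viewed as a subset of $\prod_{i\in I}V_i$ (a chamber being the tuple of its vertices), is closed in this product. Give $C$ the subspace topology. Then exactly one of the following holds: $C$ is connected, or $C$ is totally disconnected. Moreover, if $C$ is totally disconnected and infinite, then $C$ is homeomorphic to the Cantor set. -/

import Mathlib

open scoped Pointwise

/-- The standard parabolic subgroup `W_J` of a Coxeter system, generated by the simple reflections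
`s_j` with `j ∈ J`. -/
def CoxeterSystem.parabolic {B W : Type*} [Group W] {M : CoxeterMatrix B}
    (cs : CoxeterSystem M W) (J : Set B) : Subgroup W :=
  Subgroup.closure (cs.simple '' J)

/-- The Coxeter complex of a Coxeter system: its simplices are the cosets `w W_J`, with `w ∈ W` and
`J ⊆ B`. A simplex `a` is a face of the simplex `b` if `b ⊆ a` as cosets (reversed inclusion). The
simplex `w W_J` has type `Jᶜ`; the chambers are the singletons `{w} = w W_∅`, and `W = W_B` is the
empty simplex. -/
abbrev CoxeterSystem.CoxeterComplex {B W : Type*} [Group W] {M : CoxeterMatrix B}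
    (cs : CoxeterSystem M W) : Type _ :=
  {S : Set W // ∃ (w : W) (J : Set B), S = w • (cs.parabolic J : Set W)}

/-- A Coxeter system is irreducible if its generating set does not decompose into two nonempty
subsets which centralize each other. -/
def CoxeterSystem.IsIrreducible {B W : Type*} [Group W] {M : CoxeterMatrix B}
    (cs : CoxeterSystem M W) : Prop :=
  ∀ J : Set B, J.Nonempty → Jᶜ.Nonempty →
    ∃ i ∈ J, ∃ j ∈ Jᶜ, ¬ Commute (cs.simple i) (cs.simple j)

/-- A thick building with Coxeter system `cs` and vertex set `V`, as a simplicial complex (the empty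
simplex included) with a type function on its vertices and a collection of subcomplexes, the
apartments. -/
structure ThickBuilding {B W : Type*} [Group W] {M : CoxeterMatrix B}
    (cs : CoxeterSystem M W) (V : Type*) where
  /-- The simplices. -/
  simplices : Set (Finset V)
  empty_mem : ∅ ∈ simplices
  singleton_mem : ∀ v : V, {v} ∈ simplices
  down_closed : ∀ a b : Finset V, a ⊆ b → b ∈ simplices → a ∈ simplices
  /-- The type of a vertex. The type of a simplex is the set of the types of its vertices. -/
  typ : V → B
  /-- The apartments. -/
  apartments : Set (Set (Finset V))
  apartment_subset : ∀ A ∈ apartments, A ⊆ simplices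
  apartment_down_closed : ∀ A ∈ apartments, ∀ a b : Finset V, a ⊆ b → b ∈ A → a ∈ A
  /-- Every apartment is isomorphic to the Coxeter complex, by a type preserving isomorphism. -/
  apartment_iso : ∀ A ∈ apartments, ∃ e : A ≃ cs.CoxeterComplex,
    (∀ a b : A, a.1 ⊆ b.1 ↔ (e b).1 ⊆ (e a).1) ∧
    ∀ (a : A) (w : W) (J : Set B),
      (e a).1 = w • (cs.parabolic J : Set W) → typ '' (a.1 : Set V) = Jᶜ
  /-- (B1) Any two simplices lie in a common apartment. -/
  exists_apartment : ∀ a ∈ simplices, ∀ b ∈ simplices, ∃ A ∈ apartments, a ∈ A ∧ b ∈ A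
  /-- (B2) If two apartments contain the simplices `a` and `b`, then there is a type preserving
  isomorphism between them that fixes `a` and `b`. -/
  exists_iso : ∀ A ∈ apartments, ∀ A' ∈ apartments, ∀ a b : Finset V,
    a ∈ A → b ∈ A → a ∈ A' → b ∈ A' →
    ∃ e : A ≃ A',
      (∀ x y : A, x.1 ⊆ y.1 ↔ (e x).1 ⊆ (e y).1) ∧
      (∀ x : A, typ '' ((e x).1 : Set V) = typ '' (x.1 : Set V)) ∧
      (∀ x : A, x.1 = a → (e x).1 = a) ∧
      (∀ x : A, x.1 = b → (e x).1 = b)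
  /-- (B3) Thickness: every non-maximal simplex is contained in at least three maximal ones. -/
  thick : ∀ a ∈ simplices, ¬ Maximal (· ∈ simplices) a →
    3 ≤ Set.encard {c : Finset V | Maximal (· ∈ simplices) c ∧ a ⊆ c}

namespace ThickBuilding

/-- A chamber is a maximal simplex. -/
def IsChamber {B W V : Type*} [Group W] {M : CoxeterMatrix B} {cs : CoxeterSystem M W}
    (Δ : ThickBuilding cs V) (c : Finset V) : Prop :=
  Maximal (· ∈ Δ.simplices) c

/-- The set `V_i` of vertices of type `i`. -/
def VertexOfType {B W V : Type*} [Group W] {M : CoxeterMatrix B} {cs : CoxeterSystem M W}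
    (Δ : ThickBuilding cs V) (i : B) : Type _ :=
  {v : V // Δ.typ v = i}

/-- The set of chambers, a chamber being viewed as the tuple of its vertices in `∏ i, V_i`. -/
def chamberSet {B W V : Type*} [Group W] {M : CoxeterMatrix B} {cs : CoxeterSystem M W}
    (Δ : ThickBuilding cs V) : Set (∀ i : B, Δ.VertexOfType i) :=
  {x | ∃ c : Finset V, Δ.IsChamber c ∧ (c : Set V) = Set.range fun i => (x i).1}

/-- A building is spherical if its apartments are finite. -/
def IsSpherical {B W V : Type*} [Group W] {M : CoxeterMatrix B} {cs : CoxeterSystem M W}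
    (Δ : ThickBuilding cs V) : Prop :=
  ∀ A ∈ Δ.apartments, A.Finite

/-- Given topologies on the sets `V_i`, the building is a compact spherical building if it is
spherical, every `V_i` is compact (and Hausdorff), and the set of chambers is closed in the
product `∏ i, V_i`. -/
structure IsCompactSpherical {B W V : Type*} [Group W] {M : CoxeterMatrix B}
    {cs : CoxeterSystem M W} (Δ : ThickBuilding cs V)
    [∀ i : B, TopologicalSpace (Δ.VertexOfType i)] : Prop where
  spherical : Δ.IsSpherical
  compact : ∀ i : B, CompactSpace (Δ.VertexOfType i)
  hausdorff : ∀ i : B, T2Space (Δ.VertexOfType i)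
  isClosed_chamberSet : IsClosed Δ.chamberSet

end ThickBuilding

/-!
The chambers form a metric space `C` with values in the Weyl group, in which `i`-adjacency is a
closed equivalence relation, whose classes are the `i`-panels. Projection between opposite panels of
a residue is a homeomorphism. By irreducibility, topological properties of a panel with a base point
can be transported through the whole building by such perspectivities of residues of rank one and
two. If some panel contains a nontrivial connected set, then all panels do, and by double
projections in residues of rank two all panels are connected; hence so is `C`, since galleries run
through panels. Otherwise all panels are totally disconnected. A connected set of chambers opposite
to a chamber `c` then projects to a single chamber in a panel of `c`, and induction on the distance
shows that it has at most one element; hence `C` is totally disconnected.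

If `C` is infinite and totally disconnected, then every chamber is, in each of its panels, an
accumulation point of a countable set; in particular, `C` is perfect. Projections in residues of
rank two yield multi-valued functions of pairs of points in a panel that depend continuously on a
parameter `z` in another panel. They take one value on the diagonal for `z ≠ z₀`, and another value
off the diagonal for `z = z₀`. As `z` approaches `z₀` along a countable set, they exhibit the
diagonal as a countable intersection of open sets. Hence the panels are second countable, and so
is `C`, which is a finite union of continuous images of products of panels. Brouwer's
characterization of the Cantor set applies.
-/

/-! ### Coxeter groups -/

namespace CoxeterGroup

open CoxeterSystem

variable {B W : Type*} [Group W] {M : CoxeterMatrix B} (cs : CoxeterSystem M W)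

theorem reverse_alternatingWord_two_mul (i j : B) (m : ℕ) :
    (alternatingWord i j (2 * m)).reverse = alternatingWord j i (2 * m) := by
  refine List.ext_getElem (by simp) fun k hk _ => ?_
  simp only [List.length_reverse, length_alternatingWord] at hk
  rw [List.getElem_reverse, getElem_alternatingWord _ _ _ _ (by simp; omega),
    getElem_alternatingWord _ _ _ _ hk]
  simp only [length_alternatingWord]
  grind

theorem prod_map_alternatingWord_two_mul {G : Type*} [Monoid G] (f : B → G) (i j : B) (m : ℕ) :
    ((alternatingWord i j (2 * m)).map f).prod = (f i * f j) ^ m := by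
  induction m with
  | zero => simp [alternatingWord]
  | succ m ih =>
    rw [show 2 * (m + 1) = 2 * m + 1 + 1 by ring, alternatingWord_succ, alternatingWord_succ,
      pow_succ, ← ih]
    simp

theorem wordProd_alternatingWord_add_order (i j : B) (k : ℕ) :
    cs.wordProd (alternatingWord i j (2 * (k + M i j) + 1)) =
      cs.wordProd (alternatingWord i j (2 * k + 1)) := by
  rw [prod_alternatingWord_eq_mul_pow, prod_alternatingWord_eq_mul_pow,
    show (2 * (k + M i j) + 1) / 2 = k + M i j by omega, show (2 * k + 1) / 2 = k by omega,
    pow_add, simple_mul_simple_pow]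
  simp

theorem exists_leftInvSeq_alternatingWord_eq_append_self (i j : B) :
    ∃ l : List W, cs.leftInvSeq (alternatingWord i j (2 * M i j)) = l ++ l := by
  set L := cs.leftInvSeq (alternatingWord i j (2 * M i j)) with hL
  have hlen : L.length = 2 * M i j := by simp [hL]
  have hdrop : L.drop (M i j) = L.take (M i j) := by
    refine List.ext_getElem (by simp; omega) fun k _ hk => ?_
    simp only [List.length_take] at hk
    simp only [List.getElem_drop, List.getElem_take, hL]
    rw [getElem_leftInvSeq_alternatingWord cs i j _ _ (by omega),
      getElem_leftInvSeq_alternatingWord cs i j _ _ (by omega), add_comm (M i j) k,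
      ← M.symmetric j i, wordProd_alternatingWord_add_order]
  exact ⟨L.take (M i j), by conv_lhs => rw [← List.take_append_drop (M i j) L, hdrop]⟩

theorem exists_rightInvSeq_alternatingWord_eq_append_self (i j : B) :
    ∃ l : List W, cs.rightInvSeq (alternatingWord i j (2 * M i j)) = l ++ l := by
  obtain ⟨l, hl⟩ := exists_leftInvSeq_alternatingWord_eq_append_self cs j i
  refine ⟨l.reverse, ?_⟩
  rw [← List.reverse_append, ← hl, ← rightInvSeq_reverse, reverse_alternatingWord_two_mul,
    M.symmetric j i]

open Classical in
/-- The `i`-th generator of the action of `W` on `W × ℤ/2` whose second component counts, modulo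
two, how often the first component occurs in the inversion sequence of the acting word. -/
noncomputable def parityStep (i : B) : Function.End (W × ZMod 2) :=
  fun p => (cs.simple i * p.1 * cs.simple i, p.2 + if p.1 = cs.simple i then 1 else 0)

open Classical in
theorem prod_map_parityStep_apply (ω : List B) (t : W) (a : ZMod 2) :
    (ω.map (parityStep cs)).prod (t, a) =
      (cs.wordProd ω * t * (cs.wordProd ω)⁻¹, a + ((cs.rightInvSeq ω).count t : ℕ)) := by
  induction ω with
  | nil => simp [Function.End.one_def]
  | cons i ω ih =>
    have hcons : ((i :: ω).map (parityStep cs)).prod (t, a) =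
        parityStep cs i ((ω.map (parityStep cs)).prod (t, a)) := rfl
    have hconj : cs.wordProd ω * t * (cs.wordProd ω)⁻¹ = cs.simple i ↔
        (cs.wordProd ω)⁻¹ * cs.simple i * cs.wordProd ω = t := by
      constructor <;> rintro h <;> rw [← h] <;> group
    rw [hcons, ih]
    simp only [parityStep, rightInvSeq, wordProd_cons, mul_inv_rev, inv_simple, mul_assoc,
      List.count_cons, Prod.mk.injEq, true_and]
    simp only [← mul_assoc, hconj, beq_iff_eq]
    push_cast
    rw [add_assoc]

theorem isLiftable_parityStep : M.IsLiftable (parityStep cs) := by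
  classical
  intro i j
  obtain ⟨l, hl⟩ := exists_rightInvSeq_alternatingWord_eq_append_self cs i j
  have hone : cs.wordProd (alternatingWord i j (2 * M i j)) = 1 := by
    rw [wordProd, prod_map_alternatingWord_two_mul, simple_mul_simple_pow]
  rw [← prod_map_alternatingWord_two_mul]
  funext ⟨t, a⟩
  rw [prod_map_parityStep_apply, hl, hone, List.count_append]
  push_cast
  rw [CharTwo.add_self_eq_zero]
  simp [Function.End.one_def]

open Classical in
theorem natCast_count_rightInvSeq_eq_of_wordProd_eq {ω ω' : List B}
    (h : cs.wordProd ω = cs.wordProd ω') (t : W) :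
    (((cs.rightInvSeq ω).count t : ℕ) : ZMod 2) = ((cs.rightInvSeq ω').count t : ℕ) := by
  have hlift (ω : List B) : cs.lift ⟨_, isLiftable_parityStep cs⟩ (cs.wordProd ω) =
      (ω.map (parityStep cs)).prod := by
    rw [wordProd, map_list_prod, List.map_map]
    exact congrArg List.prod (List.map_congr_left fun i _ => by simp)
  have hact : (ω.map (parityStep cs)).prod (t, 0) = (ω'.map (parityStep cs)).prod (t, 0) := by
    rw [← hlift, ← hlift, h]
  rw [prod_map_parityStep_apply, prod_map_parityStep_apply] at hact
  simpa using congrArg Prod.snd hact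

theorem simple_mem_rightInvSeq_of_isRightDescent {ω : List B} {i : B}
    (h : cs.IsRightDescent (cs.wordProd ω) i) : cs.simple i ∈ cs.rightInvSeq ω := by
  classical
  obtain ⟨τ, hτ, hτω⟩ := cs.exists_isReduced (cs.wordProd ω * cs.simple i)
  have hnotMem : cs.simple i ∉ cs.rightInvSeq τ := by
    intro hmem
    have hlt := (cs.isRightInversion_of_mem_rightInvSeq hτ hmem).2
    rw [← hτω, simple_mul_simple_cancel_right] at hlt
    exact lt_asymm hlt h
  have hω : cs.wordProd ω = cs.wordProd (τ.concat i) := by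
    rw [wordProd_concat, ← hτω, simple_mul_simple_cancel_right]
  have hcount : (cs.rightInvSeq (τ.concat i)).count (cs.simple i) = 1 := by
    have hmap := List.count_map_of_injective (cs.rightInvSeq τ) (MulAut.conj (cs.simple i))
      (MulEquiv.injective _) (cs.simple i)
    rw [show MulAut.conj (cs.simple i) (cs.simple i) = cs.simple i by simp,
      List.count_eq_zero.mpr hnotMem] at hmap
    rw [rightInvSeq_concat, List.concat_eq_append, List.count_append, hmap]
    simp
  have hparity := natCast_count_rightInvSeq_eq_of_wordProd_eq cs hω (cs.simple i)
  rw [hcount] at hparity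
  by_contra hmem
  rw [List.count_eq_zero.mpr hmem] at hparity
  exact absurd hparity (by decide)

theorem exchange {ω : List B} {i : B} (h : cs.IsRightDescent (cs.wordProd ω) i) :
    ∃ n < ω.length, cs.wordProd ω * cs.simple i = cs.wordProd (ω.eraseIdx n) := by
  obtain ⟨n, hn, hni⟩ := List.mem_iff_getElem.mp (simple_mem_rightInvSeq_of_isRightDescent cs h)
  refine ⟨n, by simpa using hn, ?_⟩
  rw [← wordProd_mul_getD_rightInvSeq, List.getD_eq_getElem _ _ hn, hni]

theorem exchange_append {τ ω : List B} {i : B} (hω : cs.IsReduced (ω ++ [i]))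
    (h : cs.IsRightDescent (cs.wordProd (τ ++ ω)) i) :
    ∃ n < τ.length, cs.wordProd (τ ++ ω) * cs.simple i = cs.wordProd (τ.eraseIdx n ++ ω) := by
  obtain ⟨n, hn, he⟩ := exchange cs h
  rcases lt_or_ge n τ.length with hnτ | hnτ
  · exact ⟨n, hnτ, by rw [he, List.eraseIdx_append_of_lt_length hnτ]⟩
  · rw [List.eraseIdx_append_of_length_le hnτ, wordProd_append, wordProd_append, mul_assoc] at he
    have hle := cs.length_wordProd_le (ω.eraseIdx (n - τ.length))
    have hlen : (ω.eraseIdx (n - τ.length)).length + 1 = ω.length :=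
      List.length_eraseIdx_add_one (by simp at hn; omega)
    rw [← mul_left_cancel he, ← wordProd_singleton, ← wordProd_append, hω.eq] at hle
    simp only [List.length_append, List.length_singleton] at hle
    omega

theorem simple_mem_parabolic {J : Set B} {j : B} (hj : j ∈ J) : cs.simple j ∈ cs.parabolic J :=
  Subgroup.subset_closure ⟨j, hj, rfl⟩

theorem exists_isReduced_mul_simple {J : Set B} {ω : List B} (hω : cs.IsReduced ω)
    (hJ : ∀ k ∈ ω, k ∈ J) {j : B} (hj : j ∈ J) :
    ∃ τ : List B, cs.IsReduced τ ∧ (∀ k ∈ τ, k ∈ J) ∧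
      cs.wordProd ω * cs.simple j = cs.wordProd τ := by
  rcases cs.length_mul_simple (cs.wordProd ω) j with hlen | hlen
  · refine ⟨ω.concat j, ?_, ?_, by rw [wordProd_concat]⟩
    · rw [CoxeterSystem.IsReduced, wordProd_concat, hlen, hω.eq, List.length_concat]
    · simp only [List.concat_eq_append, List.mem_append, List.mem_singleton]
      rintro k (hk | rfl)
      exacts [hJ k hk, hj]
  · obtain ⟨n, hn, he⟩ := exchange cs (cs.isRightDescent_iff.mpr hlen)
    refine ⟨ω.eraseIdx n, ?_, fun k hk => hJ k (List.mem_of_mem_eraseIdx hk), he⟩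
    have hlen' := List.length_eraseIdx_add_one hn
    rw [hω.eq] at hlen
    rw [CoxeterSystem.IsReduced, ← he]
    omega

theorem exists_isReduced_of_mem_parabolic {J : Set B} {x : W} (hx : x ∈ cs.parabolic J) :
    ∃ ω : List B, cs.IsReduced ω ∧ (∀ j ∈ ω, j ∈ J) ∧ x = cs.wordProd ω := by
  induction hx using Subgroup.closure_induction_right with
  | one => exact ⟨[], by simp [CoxeterSystem.IsReduced], by simp, by simp⟩
  | mul_right x hx y hy ih =>
    obtain ⟨ω, hω, hJ, rfl⟩ := ih
    obtain ⟨j, hj, rfl⟩ := hy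
    exact exists_isReduced_mul_simple cs hω hJ hj
  | mul_inv_cancel x hx y hy ih =>
    obtain ⟨ω, hω, hJ, rfl⟩ := ih
    obtain ⟨j, hj, rfl⟩ := hy
    rw [inv_simple]
    exact exists_isReduced_mul_simple cs hω hJ hj

theorem length_mul_inv_add_length {J : Set B} {w x : W} (hw : ∀ j ∈ J, cs.IsRightDescent w j)
    (hx : x ∈ cs.parabolic J) : cs.length (w * x⁻¹) + cs.length x = cs.length w := by
  obtain ⟨ω, hω, hJ, rfl⟩ := exists_isReduced_of_mem_parabolic cs hx
  clear hx
  induction ω using List.reverseRecOn with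
  | nil => simp
  | append_singleton ω i ih =>
    have hω' : cs.IsReduced ω := by simpa using hω.take ω.length
    specialize ih hω' fun j hj => hJ j (by simp [hj])
    obtain ⟨τ, hτ, hτw⟩ := cs.exists_isReduced (w * (cs.wordProd ω)⁻¹)
    have hw' : w = cs.wordProd (τ ++ ω) := by rw [wordProd_append, ← hτw]; group
    obtain ⟨n, hn, he⟩ := exchange_append cs hω (hw' ▸ hw i (hJ i (by simp)))
    have herase : w * (cs.wordProd (ω ++ [i]))⁻¹ = cs.wordProd (τ.eraseIdx n) := by
      rw [wordProd_append cs ω, wordProd_singleton, mul_inv_rev, inv_simple, ← mul_assoc, hw', he,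
        wordProd_append, mul_inv_cancel_right]
    have hupper := cs.length_wordProd_le (τ.eraseIdx n)
    have hlower := cs.length_le_length_mul_add_right w (cs.wordProd (ω ++ [i]))⁻¹
    have hlen := List.length_eraseIdx_add_one hn
    rw [hτw, hτ.eq, hω'.eq] at ih
    rw [← herase] at hupper
    rw [length_inv, hω.eq] at hlower
    rw [hω.eq]
    simp only [List.length_append, List.length_singleton] at hlower ⊢
    omega

/-- An element of maximal length in a standard parabolic subgroup. -/
structure IsLongest (J : Set B) (w : W) : Prop where
  mem : w ∈ cs.parabolic J
  length_le : ∀ x ∈ cs.parabolic J, cs.length x ≤ cs.length w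

theorem exists_isLongest [Finite W] (J : Set B) : ∃ w, IsLongest cs J w := by
  obtain ⟨w, hw⟩ := Finite.exists_max (fun x : cs.parabolic J => cs.length (x : W))
  exact ⟨w, w.2, fun x hx => hw ⟨x, hx⟩⟩

variable {cs} {J : Set B} {w x : W}

namespace IsLongest

theorem length_mul_add_length (hw : IsLongest cs J w) (hx : x ∈ cs.parabolic J) :
    cs.length (w * x) + cs.length x = cs.length w := by
  have hdesc (j : B) (hj : j ∈ J) : cs.IsRightDescent w j :=
    (hw.length_le _ (mul_mem hw.mem (simple_mem_parabolic cs hj))).lt_of_ne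
      (cs.length_mul_simple_ne w j)
  simpa using length_mul_inv_add_length cs hdesc (inv_mem hx)

theorem inv (hw : IsLongest cs J w) : IsLongest cs J w⁻¹ :=
  ⟨inv_mem hw.mem, by simpa using hw.length_le⟩

theorem length_mul_add_length' (hw : IsLongest cs J w) (hx : x ∈ cs.parabolic J) :
    cs.length (x * w) + cs.length x = cs.length w := by
  have h := hw.inv.length_mul_add_length (inv_mem hx)
  rwa [← mul_inv_rev, length_inv, length_inv, length_inv] at h

theorem mul_self (hw : IsLongest cs J w) : w * w = 1 := by
  have h := hw.length_mul_add_length hw.mem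
  rw [← cs.length_eq_zero_iff]
  omega

theorem isLeftDescent (hw : IsLongest cs J w) {j : B} (hj : j ∈ J) : cs.IsLeftDescent w j := by
  have h := hw.length_mul_add_length' (simple_mem_parabolic cs hj)
  rw [length_simple] at h
  rw [IsLeftDescent]
  omega

theorem exists_simple_mul_eq_mul_simple (hw : IsLongest cs J w) {j : B} (hj : j ∈ J) :
    ∃ k ∈ J, cs.simple j * w = w * cs.simple k := by
  have hs := simple_mem_parabolic cs hj
  have hmem : cs.simple j * w ∈ cs.parabolic J := mul_mem hs hw.mem
  have hlen : cs.length (w * (cs.simple j * w)) = 1 := by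
    have h₁ := hw.length_mul_add_length' hs
    have h₂ := hw.length_mul_add_length hmem
    rw [cs.length_simple] at h₁
    omega
  obtain ⟨ω, hω, hJ, he⟩ := exists_isReduced_of_mem_parabolic cs (mul_mem hw.mem hmem)
  rw [he, hω.eq] at hlen
  obtain ⟨k, rfl⟩ := List.length_eq_one_iff.mp hlen
  rw [wordProd_singleton] at he
  exact ⟨k, hJ k (by simp), by rw [← he, ← mul_assoc, hw.mul_self, one_mul]⟩

theorem isLeftDescent_mul (hw : IsLongest cs J w) {g : W} (hg : g ∈ cs.parabolic J) {i : B}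
    (hi : i ∈ J) (hlt : cs.length g < cs.length (cs.simple i * g)) :
    cs.IsLeftDescent (g * w) i := by
  have h₁ := hw.length_mul_add_length' hg
  have h₂ := hw.length_mul_add_length' (mul_mem (simple_mem_parabolic cs hi) hg)
  rw [mul_assoc] at h₂
  rw [IsLeftDescent]
  omega

theorem isRightDescent_mul (hw : IsLongest cs J w) {g : W} (hg : g ∈ cs.parabolic J) {i k : B}
    (hi : i ∈ J) (hk : cs.simple i * w = w * cs.simple k)
    (hlt : cs.length g < cs.length (g * cs.simple i)) : cs.IsRightDescent (g * w) k := by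
  have h₁ := hw.length_mul_add_length' hg
  have h₂ := hw.length_mul_add_length' (mul_mem hg (simple_mem_parabolic cs hi))
  rw [mul_assoc, hk, ← mul_assoc] at h₂
  rw [IsRightDescent]
  omega

theorem eq_of_length_le (hw : IsLongest cs Set.univ w) (hx : cs.length w ≤ cs.length x) :
    x = w := by
  have hmem : x⁻¹ ∈ cs.parabolic Set.univ := by
    rw [parabolic, Set.image_univ, subgroup_closure_range_simple]
    trivial
  have h := hw.length_mul_add_length' hmem
  rw [length_inv] at h
  have hone : x⁻¹ * w = 1 := by
    rw [← cs.length_eq_zero_iff]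
    omega
  exact inv_mul_eq_one.mp hone

end IsLongest

theorem length_simple_mul_simple_of_ne {i j : B} (h : cs.simple i ≠ cs.simple j) :
    cs.length (cs.simple i * cs.simple j) = 2 := by
  rcases cs.length_simple_mul (cs.simple j) i with hlen | hlen
  · rw [hlen, length_simple]
  · rw [length_simple, Nat.add_eq_right, length_eq_zero_iff, mul_eq_one_iff_eq_inv,
      inv_simple] at hlen
    exact absurd hlen h

theorem length_simple_mul_simple_mul_simple {i j : B}
    (h : ¬ Commute (cs.simple i) (cs.simple j)) :
    cs.length (cs.simple i * cs.simple j * cs.simple i) = 3 := by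
  have htwo := length_simple_mul_simple_of_ne (cs := cs) fun he => h (by rw [he])
  rcases cs.length_mul_simple (cs.simple i * cs.simple j) i with hlen | hlen
  · rw [hlen, htwo]
  exfalso
  have hword : cs.wordProd [i, j] = cs.simple i * cs.simple j := by simp [wordProd_cons]
  obtain ⟨n, hn, he⟩ := exchange cs (hword ▸ cs.isRightDescent_iff.mpr hlen)
  rw [hword] at he
  simp only [List.length_cons, List.length_nil] at hn
  interval_cases n
  · rw [List.eraseIdx_cons_zero, wordProd_singleton] at he
    have hcomm := congrArg (· * cs.simple i) he
    simp only [simple_mul_simple_cancel_right] at hcomm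
    exact h hcomm
  · rw [List.eraseIdx_cons_succ, List.eraseIdx_cons_zero, wordProd_singleton, mul_assoc,
      mul_eq_left, mul_eq_one_iff_eq_inv, inv_simple] at he
    exact h (by rw [he])

theorem exists_not_commute_of_isIrreducible [Nontrivial B] (h : cs.IsIrreducible) (i : B) :
    ∃ j, ¬ Commute (cs.simple i) (cs.simple j) := by
  obtain ⟨k, hk⟩ := exists_ne i
  obtain ⟨i', hi', j, -, hij⟩ := h {i} ⟨i, rfl⟩ ⟨k, hk⟩
  exact ⟨j, Set.mem_singleton_iff.mp hi' ▸ hij⟩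

variable (cs) in
/-- The longest element `w` of a nonabelian standard parabolic subgroup `⟨s_i, s_j⟩` of rank two,
together with the involution `i ↦ i'`, `j ↦ j'` of its generators induced by conjugation with `w`.
An element at distance `g w` is thought of as being at codistance `g`. -/
structure RankTwo (i j i' j' : B) (w : W) : Prop where
  not_commute : ¬ Commute (cs.simple i) (cs.simple j)
  isLongest : IsLongest cs {i, j} w
  fst_mul : cs.simple i * w = w * cs.simple i'
  snd_mul : cs.simple j * w = w * cs.simple j'

theorem exists_rankTwo [Finite W] {i j : B} (hij : ¬ Commute (cs.simple i) (cs.simple j)) :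
    ∃ i' j' w, RankTwo cs i j i' j' w := by
  obtain ⟨w, hw⟩ := exists_isLongest cs {i, j}
  obtain ⟨i', -, hi'⟩ := hw.exists_simple_mul_eq_mul_simple (j := i) (by simp)
  obtain ⟨j', -, hj'⟩ := hw.exists_simple_mul_eq_mul_simple (j := j) (by simp)
  exact ⟨i', j', w, hij, hw, hi', hj'⟩

namespace RankTwo

variable {i j i' j' : B}

theorem symm (h : RankTwo cs i j i' j' w) : RankTwo cs j i j' i' w :=
  ⟨fun hc => h.not_commute hc.symm, Set.pair_comm i j ▸ h.isLongest, h.snd_mul, h.fst_mul⟩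

theorem simple_ne (h : RankTwo cs i j i' j' w) : cs.simple i ≠ cs.simple j :=
  fun he => h.not_commute (by rw [he])

theorem isLeftDescent (h : RankTwo cs i j i' j' w) : cs.IsLeftDescent w i := by
  simpa using h.isLongest.isLeftDescent_mul (one_mem _) (Set.mem_insert i {j}) (by simp)

theorem isLeftDescent_simple_mul (h : RankTwo cs i j i' j' w) :
    cs.IsLeftDescent (cs.simple j * w) i := by
  refine h.isLongest.isLeftDescent_mul (simple_mem_parabolic cs (by simp)) (by simp) ?_
  rw [length_simple, length_simple_mul_simple_of_ne h.simple_ne]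
  exact one_lt_two

theorem isLeftDescent_simple_mul_simple_mul (h : RankTwo cs i j i' j' w) :
    cs.IsLeftDescent (cs.simple i * (cs.simple j * w)) j := by
  rw [← mul_assoc]
  refine h.isLongest.isLeftDescent_mul
    (mul_mem (simple_mem_parabolic cs (by simp)) (simple_mem_parabolic cs (by simp))) (by simp) ?_
  rw [← mul_assoc, length_simple_mul_simple_of_ne h.simple_ne,
    length_simple_mul_simple_mul_simple h.symm.not_commute]
  exact Nat.lt_succ_self 2

theorem isRightDescent (h : RankTwo cs i j i' j' w) : cs.IsRightDescent w i' := by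
  simpa using h.isLongest.isRightDescent_mul (one_mem _) (Set.mem_insert i {j}) h.fst_mul (by simp)

theorem isRightDescent_simple_mul (h : RankTwo cs i j i' j' w) :
    cs.IsRightDescent (cs.simple j * w) i' := by
  refine h.isLongest.isRightDescent_mul (simple_mem_parabolic cs (by simp)) (by simp) h.fst_mul ?_
  rw [length_simple, length_simple_mul_simple_of_ne h.simple_ne.symm]
  exact one_lt_two

theorem isRightDescent_simple_mul_simple_mul (h : RankTwo cs i j i' j' w) :
    cs.IsRightDescent (cs.simple i * (cs.simple j * w)) i' := by
  rw [← mul_assoc]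
  refine h.isLongest.isRightDescent_mul
    (mul_mem (simple_mem_parabolic cs (by simp)) (simple_mem_parabolic cs (by simp))) (by simp)
    h.fst_mul ?_
  rw [length_simple_mul_simple_of_ne h.simple_ne, length_simple_mul_simple_mul_simple h.not_commute]
  exact Nat.lt_succ_self 2

end RankTwo

end CoxeterGroup

/-! ### Topology -/

section ClosedRelations

open Topology Set

variable {X Y : Type*} [TopologicalSpace X] [TopologicalSpace Y] {R : X → Y → Prop}

theorem isClosed_setOf_exists [CompactSpace Y] (hR : IsClosed {p : X × Y | R p.1 p.2}) :
    IsClosed {x | ∃ y, R x y} := by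
  convert isClosedMap_fst_of_compactSpace _ hR using 1
  ext x
  simp

theorem continuous_of_isClosed_rel [CompactSpace Y] (hR : IsClosed {p : X × Y | R p.1 p.2})
    {f : X → Y} (hf : ∀ x, R x (f x)) (huniq : ∀ x y, R x y → y = f x) : Continuous f := by
  refine continuous_iff_isClosed.mpr fun F hF => ?_
  have hpre : f ⁻¹' F = {x | ∃ y, y ∈ F ∧ R x y} := by
    ext x
    refine ⟨fun hx => ⟨f x, hx, hf x⟩, ?_⟩
    rintro ⟨y, hy, hxy⟩
    rwa [mem_preimage, ← huniq x y hxy]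
  rw [hpre]
  exact isClosed_setOf_exists ((hF.preimage continuous_snd).inter hR)

theorem isPreconnected_setOf_exists_mem_rel [CompactSpace Y]
    (hR : IsClosed {p : X × Y | R p.1 p.2}) {K : Set X} (hK : IsPreconnected K)
    (hex : ∀ x ∈ K, ∃! y, R x y) : IsPreconnected {y | ∃ x ∈ K, R x y} := by
  choose f hf huniq using hex
  have hcont : Continuous fun x : K => f x x.2 :=
    continuous_of_isClosed_rel (R := fun (x : K) y => R x y)
      (hR.preimage (continuous_subtype_val.prodMap continuous_id))
      (fun x => hf x x.2) fun x y h => huniq x x.2 y h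
  have himage : {y | ∃ x ∈ K, R x y} = range fun x : K => f x x.2 := by
    ext y
    constructor
    · rintro ⟨x, hx, hxy⟩
      exact ⟨⟨x, hx⟩, (huniq x hx y hxy).symm⟩
    · rintro ⟨x, rfl⟩
      exact ⟨x, x.2, hf x x.2⟩
  have : PreconnectedSpace K := isPreconnected_iff_preconnectedSpace.mp hK
  exact himage ▸ isPreconnected_range hcont

theorem exists_homeomorph_of_isClosed_rel [CompactSpace X] [CompactSpace Y]
    (hR : IsClosed {p : X × Y | R p.1 p.2}) (hright : ∀ x, ∃! y, R x y)
    (hleft : ∀ y, ∃! x, R x y) : ∃ e : X ≃ₜ Y, ∀ x, R x (e x) := by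
  choose f hf hfu using hright
  choose g hg hgu using hleft
  refine ⟨⟨⟨f, g, fun x => (hgu _ x (hf x)).symm, fun y => (hfu _ y (hg y)).symm⟩,
    continuous_of_isClosed_rel hR hf hfu, ?_⟩, hf⟩
  exact continuous_of_isClosed_rel (R := fun y x => R x y) (hR.preimage continuous_swap) hg hgu

end ClosedRelations

section CompactHausdorff

open Topology Set TopologicalSpace

variable {X Y : Type*} [TopologicalSpace X] [TopologicalSpace Y]

/- The diagonal is the zero set of a function on `X × X`; currying it embeds `X` into the metric
space `C(X, ℝ)`. -/
theorem secondCountableTopology_of_isGδ_diagonal [CompactSpace X] [T2Space X]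
    (h : IsGδ (diagonal X)) : SecondCountableTopology X := by
  obtain ⟨f, hf, -⟩ := exists_continuous_one_zero_of_isCompact_of_isGδ isClosed_diagonal.isCompact
    h isClosed_empty (disjoint_empty _)
  have heq (x y : X) : f (x, y) = 1 ↔ x = y := by
    rw [← mem_diagonal_iff (x := (x, y)), hf, mem_preimage, mem_singleton_iff]
  have hinj : Function.Injective f.curry := fun x y hxy => by
    rw [← heq, ← ContinuousMap.curry_apply, hxy, ContinuousMap.curry_apply, heq]
  have := (f.curry.continuous.isClosedEmbedding hinj).isEmbedding.metrizableSpace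
  let := metrizableSpaceMetric X
  infer_instance

theorem secondCountableTopology_of_surjective [CompactSpace X] [T2Space X]
    [SecondCountableTopology X] [T2Space Y] {f : X → Y} (hf : Continuous f)
    (hs : Function.Surjective f) : SecondCountableTopology Y := by
  have : CompactSpace Y := hs.compactSpace hf
  let := metrizableSpaceMetric (X × X)
  have hff : Continuous (Prod.map f f) := hf.prodMap hf
  obtain ⟨U, hU, hdiag⟩ := (isClosed_diagonal.preimage hff).isGδ.eq_iInter_nat
  have himage : diagonal Y = ⋂ n, (Prod.map f f '' (U n)ᶜ)ᶜ := by
    rw [← compl_iUnion, ← image_iUnion, ← compl_iInter, ← hdiag, ← preimage_compl,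
      image_preimage_eq _ (hs.prodMap hs), compl_compl]
  refine secondCountableTopology_of_isGδ_diagonal (himage ▸ .iInter_of_isOpen fun n => ?_)
  exact (hff.isClosedMap _ (hU n).isClosed_compl).isOpen_compl

theorem secondCountableTopology_of_isGδ_diagonal_diff [CompactSpace X] [T2Space X] [Nontrivial X]
    (h : ∀ c : X, IsGδ (diagonal X \ {(c, c)})) : SecondCountableTopology X := by
  obtain ⟨c, d, hcd⟩ := exists_pair_ne X
  have hunion : diagonal X \ {(c, c)} ∪ diagonal X \ {(d, d)} = diagonal X := by
    rw [← sdiff_inter, singleton_inter_eq_empty.mpr (by simpa using hcd), sdiff_empty]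
  exact secondCountableTopology_of_isGδ_diagonal (hunion ▸ (h c).union (h d))

/-- The relation `F z` is viewed as a multi-valued function of two variables. At a point off the
diagonal, its values for `z ∈ S` close to `z₀` are close to `y₀`, hence different from `y₁`. -/
theorem isGδ_diagonal_diff_of_isClosed_rel {Z : Type*} [TopologicalSpace Z] [T1Space X]
    [CompactSpace Y] [T2Space Y] {F : Z → X → X → Y → Prop}
    (hF : IsClosed {q : (Z × X × X) × Y | F q.1.1 q.1.2.1 q.1.2.2 q.2}) {S : Set Z}
    (hS : S.Countable) {z₀ : Z} (hz₀ : z₀ ∈ closure S) {x₀ : X} {y₀ y₁ : Y} (hne : y₀ ≠ y₁)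
    (hex : ∀ z ∈ S, ∀ x x', x ≠ x₀ → x' ≠ x₀ → ∃ y, F z x x' y)
    (hdiag : ∀ z ∈ S, ∀ x y, x ≠ x₀ → F z x x y → y = y₁)
    (hoff : ∀ x x' y, x ≠ x₀ → x' ≠ x₀ → x ≠ x' → F z₀ x x' y → y = y₀) :
    IsGδ (diagonal X \ {(x₀, x₀)}) := by
  obtain ⟨U, V, hU, hV, hyU, hyV, hUV⟩ := t2_separation hne
  have hclosed {A : Set Y} (hA : IsClosed A) :
      IsClosed {q : Z × X × X | ∃ y, y ∈ A ∧ F q.1 q.2.1 q.2.2 y} :=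
    isClosed_setOf_exists ((hA.preimage continuous_snd).and hF)
  have heq : diagonal X \ {(x₀, x₀)} = {p | p.1 ≠ x₀ ∧ p.2 ≠ x₀} ∩
      ⋂ z ∈ S, {p : X × X | ∃ y, y ∈ Vᶜ ∧ F z p.1 p.2 y}ᶜ := by
    ext ⟨x, x'⟩
    simp only [mem_sdiff, mem_diagonal_iff, mem_singleton_iff, Prod.mk.injEq, mem_inter_iff,
      mem_ofPred_eq, mem_iInter, mem_compl_iff]
    constructor
    · rintro ⟨rfl, hx⟩
      simp only [and_self] at hx
      exact ⟨⟨hx, hx⟩, fun z hz ⟨y, hy, hFy⟩ => hy (hdiag z hz x y hx hFy ▸ hyV)⟩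
    · rintro ⟨⟨hx, hx'⟩, h⟩
      refine ⟨?_, fun hxx => hx hxx.1⟩
      by_contra hxx'
      have hopen : IsOpen {z | ∃ y, y ∈ Uᶜ ∧ F z x x' y}ᶜ :=
        ((hclosed hU.isClosed_compl).preimage (f := fun z => (z, x, x'))
          (by fun_prop)).isOpen_compl
      obtain ⟨z, hzU, hzS⟩ := mem_closure_iff.mp hz₀ _ hopen
        fun ⟨y, hy, hFy⟩ => hy (hoff x x' y hx hx' hxx' hFy ▸ hyU)
      obtain ⟨y, hFy⟩ := hex z hzS x x' hx hx'
      exact h z hzS ⟨y, fun hyV' => hzU ⟨y, disjoint_right.mp hUV hyV', hFy⟩, hFy⟩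
  rw [heq]
  refine IsGδ.inter ?_ (.biInter hS fun z _ => ?_)
  · exact ((isOpen_ne.preimage continuous_fst).inter (isOpen_ne.preimage continuous_snd)).isGδ
  · exact ((hclosed hV.isClosed_compl).preimage (f := fun p : X × X => (z, p))
      (by fun_prop)).isOpen_compl.isGδ

theorem secondCountableTopology_iUnion {ι : Type*} [Finite ι] [T2Space X] {K : ι → Set X}
    (hK : ∀ i, IsCompact (K i)) (hs : ∀ i, SecondCountableTopology (K i)) :
    SecondCountableTopology (⋃ i, K i : Set X) := by
  have (i : ι) : CompactSpace (K i) := isCompact_iff_compactSpace.mp (hK i)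
  refine secondCountableTopology_of_surjective
    (f := fun p : Σ i, K i => (⟨p.2, mem_iUnion.mpr ⟨p.1, p.2.2⟩⟩ : (⋃ i, K i : Set X)))
    ((continuous_sigma fun i => continuous_subtype_val).subtype_mk _) ?_
  rintro ⟨x, hx⟩
  obtain ⟨i, hi⟩ := mem_iUnion.mp hx
  exact ⟨⟨i, x, hi⟩, rfl⟩

theorem secondCountableTopology_setOf_exists_rel [CompactSpace X] [T2Space X]
    [SecondCountableTopology X] [CompactSpace Y] [T2Space Y] {R : X → Y → Prop}
    (hR : IsClosed {p : X × Y | R p.1 p.2}) (hex : ∀ x, ∃! y, R x y) :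
    SecondCountableTopology {y | ∃ x, R x y} := by
  choose f hf huniq using hex
  have hcont : Continuous f := continuous_of_isClosed_rel hR hf huniq
  refine secondCountableTopology_of_surjective
    (f := fun x => (⟨f x, x, hf x⟩ : {y | ∃ x, R x y})) (hcont.subtype_mk _) ?_
  rintro ⟨y, x, hxy⟩
  exact ⟨x, Subtype.ext (huniq x y hxy).symm⟩

theorem exists_isClopen_subset_of_isTotallyDisconnected [CompactSpace X] [T2Space X] {U : Set X}
    (hU : IsOpen U) (hUd : IsTotallyDisconnected U) {d : X} (hd : d ∈ U) :
    ∃ V : Set X, IsClopen V ∧ d ∈ V ∧ V ⊆ U := by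
  obtain ⟨F, hF, hFc, hFU⟩ := exists_mem_nhds_isClosed_subset (hU.mem_nhds hd)
  have : CompactSpace F := isCompact_iff_compactSpace.mp hFc.isCompact
  have : TotallyDisconnectedSpace F :=
    totallyDisconnectedSpace_subtype_iff.mpr fun K hK => hUd K (hK.trans hFU)
  obtain ⟨V, hV, hdV, hVF⟩ := compact_exists_isClopen_in_isOpen
    (isOpen_interior.preimage continuous_subtype_val)
    (x := (⟨d, mem_of_mem_nhds hF⟩ : F)) (mem_interior_iff_mem_nhds.mpr hF)
  refine ⟨Subtype.val '' V, ⟨hFc.isClosedEmbedding_subtypeVal.isClosedMap _ hV.1, ?_⟩,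
    ⟨_, hdV, rfl⟩, ?_⟩
  · obtain ⟨O, hO, rfl⟩ := isOpen_induced_iff.mp hV.2
    have himage : Subtype.val '' ((Subtype.val : F → X) ⁻¹' O) = O ∩ interior F := by
      rw [Subtype.image_preimage_coe]
      refine Subset.antisymm (fun z hz => ⟨hz.2, hVF (a := ⟨z, hz.1⟩) hz.2⟩) fun z hz => ?_
      exact ⟨interior_subset hz.2, hz.1⟩
    exact himage ▸ hO.inter isOpen_interior
  · rintro _ ⟨z, -, rfl⟩
    exact hFU z.2

theorem totallyDisconnectedSpace_of_isOpen_cover [CompactSpace X] [T2Space X]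
    (h : ∀ d : X, ∃ U : Set X, IsOpen U ∧ d ∈ U ∧ IsTotallyDisconnected U) :
    TotallyDisconnectedSpace X := by
  refine ⟨fun K _ hK x hx y hy => by_contra fun hxy => ?_⟩
  obtain ⟨U, hU, hxU, hUd⟩ := h x
  obtain ⟨V, hV, hxV, hVU⟩ := exists_isClopen_subset_of_isTotallyDisconnected
    (hU.inter (isOpen_ne (x := y)))
    (fun K hK => hUd K (hK.trans inter_subset_left)) ⟨hxU, hxy⟩
  exact (hVU (hK.subset_isClopen hV ⟨x, hx, hxV⟩ hy)).2 rfl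

theorem exists_isPreconnected_nontrivial_notMem [CompactSpace X] [T2Space X] [PreconnectedSpace X]
    [Nontrivial X] (c : X) : ∃ K : Set X, IsPreconnected K ∧ K.Nontrivial ∧ c ∉ K := by
  by_contra! hcon
  have hUd : IsTotallyDisconnected {c}ᶜ := fun K hK hp =>
    not_nontrivial_iff.mp fun hn => hK (hcon K hp hn) rfl
  obtain ⟨d, hd⟩ := exists_ne c
  obtain ⟨V, hV, hdV, hVc⟩ :=
    exists_isClopen_subset_of_isTotallyDisconnected isOpen_compl_singleton hUd hd
  rcases isClopen_iff.mp hV with rfl | rfl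
  · exact hdV
  · exact hVc (mem_univ c) rfl

end CompactHausdorff

section PointProperties

open Set

variable {X Y : Type*} [TopologicalSpace X] [TopologicalSpace Y] {x : X}

/-- Some nontrivial connected subset of the space avoids the point. -/
def HasPuncturedContinuum (x : X) : Prop :=
  ∃ K : Set X, IsPreconnected K ∧ K.Nontrivial ∧ x ∉ K

theorem HasPuncturedContinuum.map_homeomorph (e : X ≃ₜ Y) (h : HasPuncturedContinuum x) :
    HasPuncturedContinuum (e x) := by
  obtain ⟨K, hK, hne, hx⟩ := h
  exact ⟨e '' K, hK.image e e.continuous.continuousOn, hne.image e.injective,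
    e.injective.mem_set_image.not.mpr hx⟩

theorem exists_hasPuncturedContinuum [CompactSpace X] [T2Space X]
    (h : ¬ TotallyDisconnectedSpace X) : ∃ x : X, HasPuncturedContinuum x := by
  obtain ⟨K, hK, hne⟩ : ∃ K : Set X, IsPreconnected K ∧ K.Nontrivial := by
    by_contra! hcon
    exact h ⟨fun K _ hK => hcon K hK⟩
  by_cases hKu : K = univ
  · have : PreconnectedSpace X := ⟨hKu ▸ hK⟩
    have : Nontrivial X := nontrivial_of_nontrivial hne
    have : Nonempty X := inferInstance
    exact ⟨Classical.arbitrary X, exists_isPreconnected_nontrivial_notMem _⟩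
  · obtain ⟨x, hx⟩ := (ne_univ_iff_exists_notMem K).mp hKu
    exact ⟨x, K, hK, hne, hx⟩

/-- The point is an accumulation point of a countable set. -/
def IsCountableAccPt (x : X) : Prop := ∃ S : Set X, S.Countable ∧ x ∉ S ∧ x ∈ closure S

theorem IsCountableAccPt.map_homeomorph (e : X ≃ₜ Y) (h : IsCountableAccPt x) :
    IsCountableAccPt (e x) := by
  obtain ⟨S, hS, hx, hcl⟩ := h
  exact ⟨e '' S, hS.image e, e.injective.mem_set_image.not.mpr hx,
    e.image_closure S ▸ mem_image_of_mem e hcl⟩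

theorem exists_isCountableAccPt [CompactSpace X] [Infinite X] : ∃ x : X, IsCountableAccPt x := by
  obtain ⟨x, hacc⟩ := (infinite_range_of_injective
    (Infinite.natEmbedding X).injective).exists_accPt_principal
  rw [accPt_principal_iff_clusterPt, ← mem_closure_iff_clusterPt] at hacc
  exact ⟨x, range (Infinite.natEmbedding X) \ {x}, (countable_range _).mono sdiff_subset,
    fun h => h.2 rfl, hacc⟩

end PointProperties

/-! ### Brouwer's theorem -/

section Brouwer

open Set TopologicalSpace PiNat

variable {X : Type*} [TopologicalSpace X]

theorem clopens_ne_bot_iff_exists_mem {D : Clopens X} : D ≠ ⊥ ↔ ∃ x, x ∈ D := by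
  rw [← SetLike.coe_ne_coe]
  exact nonempty_iff_ne_empty.symm

theorem exists_clopens_nontrivial_partition [CompactSpace X] [T2Space X]
    [TotallyDisconnectedSpace X] (hperf : ∀ x : X, ¬ IsOpen {x}) {D : Clopens X} (hD : D ≠ ⊥) :
    ∃ D' ≤ D, D' ≠ ⊥ ∧ D \ D' ≠ ⊥ := by
  obtain ⟨x, hx⟩ := clopens_ne_bot_iff_exists_mem.mp hD
  obtain ⟨y, hy, hyx⟩ : ∃ y ∈ D, y ≠ x := by
    by_contra! h
    have hsingle : (D : Set X) = {x} := Subset.antisymm h (singleton_subset_iff.mpr hx)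
    exact hperf x (hsingle ▸ D.isClopen.isOpen)
  obtain ⟨V, hV, hxV, hVy⟩ := compact_exists_isClopen_in_isOpen (isOpen_ne (x := y)) hyx.symm
  refine ⟨D ⊓ ⟨V, hV⟩, inf_le_left, clopens_ne_bot_iff_exists_mem.mpr ⟨x, hx, hxV⟩,
    clopens_ne_bot_iff_exists_mem.mpr ⟨y, hy, fun h => hVy h.2 rfl⟩⟩

theorem exists_clopens_partition_deciding [CompactSpace X] [T2Space X]
    [TotallyDisconnectedSpace X] (hperf : ∀ x : X, ¬ IsOpen {x}) (U D : Clopens X) (hD : D ≠ ⊥) :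
    ∃ F : Bool → Clopens X, F false ⊔ F true = D ∧ Disjoint (F false) (F true) ∧
      ∀ b, F b ≠ ⊥ ∧ (F b ≤ U ∨ Disjoint (F b) U) := by
  have hsplit (D' : Clopens X) (hle : D' ≤ D) (hne : D' ≠ ⊥) (hne' : D \ D' ≠ ⊥)
      (hU : D' ≤ U ∨ Disjoint D' U) (hU' : D \ D' ≤ U ∨ Disjoint (D \ D') U) :
      ∃ F : Bool → Clopens X, F false ⊔ F true = D ∧ Disjoint (F false) (F true) ∧
        ∀ b, F b ≠ ⊥ ∧ (F b ≤ U ∨ Disjoint (F b) U) :=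
    ⟨fun b => cond b D' (D \ D'), sdiff_sup_cancel hle, disjoint_sdiff_self_left,
      Bool.forall_bool.mpr ⟨⟨hne', hU'⟩, hne, hU⟩⟩
  by_cases hdisj : D ⊓ U = ⊥
  · obtain ⟨D', hle, hne, hne'⟩ := exists_clopens_nontrivial_partition hperf hD
    have hDU : Disjoint D U := disjoint_iff.mpr hdisj
    exact hsplit D' hle hne hne' (Or.inr (hDU.mono_left hle)) (Or.inr (hDU.mono_left sdiff_le))
  by_cases hsub : D \ U = ⊥
  · obtain ⟨D', hle, hne, hne'⟩ := exists_clopens_nontrivial_partition hperf hD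
    have hDU : D ≤ U := sdiff_eq_bot_iff.mp hsub
    exact hsplit D' hle hne hne' (Or.inl (hle.trans hDU)) (Or.inl (sdiff_le.trans hDU))
  · refine hsplit (D ⊓ U) inf_le_left hdisj ?_ (Or.inl inf_le_right) ?_ <;>
      rw [sdiff_inf_self_left]
    exacts [hsub, Or.inr disjoint_sdiff_self_left]

/-- A binary scheme of nonempty clopen sets in the sense of `CantorScheme`, in which the children
of each set partition it and each clopen set is a union of sets of some level. -/
structure IsClopenScheme (A : List Bool → Clopens X) : Prop where
  ne_bot : ∀ l, A l ≠ ⊥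
  nil : A [] = ⊤
  sup : ∀ l, A (false :: l) ⊔ A (true :: l) = A l
  disjoint : ∀ l, Disjoint (A (false :: l)) (A (true :: l))
  decides : ∀ V : Clopens X, ∃ n, ∀ l : List Bool, l.length = n → A l ≤ V ∨ Disjoint (A l) V

theorem exists_isClopenScheme [CompactSpace X] [T2Space X] [TotallyDisconnectedSpace X]
    [SecondCountableTopology X] [Nonempty X] (hperf : ∀ x : X, ¬ IsOpen {x}) :
    ∃ A : List Bool → Clopens X, IsClopenScheme A := by
  have : Countable (Clopens X) := Clopens.countable_iff_secondCountable.mpr inferInstance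
  obtain ⟨U, hU⟩ := exists_surjective_nat (Clopens X)
  choose! F hsup hdisj hF using exists_clopens_partition_deciding hperf
  let A : List Bool → Clopens X := fun l => l.rec ⊤ fun b l D => F (U l.length) D b
  have hne (l : List Bool) : A l ≠ ⊥ := by
    induction l with
    | nil => exact clopens_ne_bot_iff_exists_mem.mpr ⟨Classical.arbitrary X, trivial⟩
    | cons b l ih => exact (hF _ _ ih b).1
  refine ⟨A, hne, rfl, fun l => hsup _ _ (hne l), fun l => hdisj _ _ (hne l), fun V => ?_⟩
  obtain ⟨n, rfl⟩ := hU V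
  refine ⟨n + 1, fun l hl => ?_⟩
  obtain ⟨b, l, rfl⟩ := List.exists_cons_of_length_eq_add_one hl
  rw [← Nat.succ.inj hl]
  exact (hF _ _ (hne l) b).2

namespace IsClopenScheme

variable {A : List Bool → Clopens X}

theorem cons_le (hA : IsClopenScheme A) (b : Bool) (l : List Bool) : A (b :: l) ≤ A l := by
  rw [← hA.sup l]
  cases b
  exacts [le_sup_left, le_sup_right]

theorem cantorScheme_disjoint (hA : IsClopenScheme A) :
    CantorScheme.Disjoint fun l => (A l : Set X) := by
  have hdisj (l : List Bool) : Disjoint (A (false :: l) : Set X) (A (true :: l)) := by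
    have h := congrArg (fun D : Clopens X => (D : Set X)) (hA.disjoint l).eq_bot
    exact disjoint_iff_inter_eq_empty.mpr h
  rintro l (_ | _) (_ | _) hab
  exacts [absurd rfl hab, hdisj l, (hdisj l).symm, absurd rfl hab]

theorem mem_of_mem_res (hA : IsClopenScheme A) {x : ℕ → Bool} {a b : X} {V : Clopens X}
    (ha : ∀ n, a ∈ A (res x n)) (hb : ∀ n, b ∈ A (res x n)) (haV : a ∈ V) : b ∈ V := by
  obtain ⟨n, hn⟩ := hA.decides V
  rcases hn (res x n) (res_length x n) with h | h
  · exact h (hb n)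
  · have hmem : a ∈ A (res x n) ⊓ V := ⟨ha n, haV⟩
    rw [h.eq_bot] at hmem
    exact hmem.elim

theorem iInter_res_nonempty [CompactSpace X] (hA : IsClopenScheme A) (x : ℕ → Bool) :
    (⋂ n, (A (res x n) : Set X)).Nonempty :=
  IsCompact.nonempty_iInter_of_sequence_nonempty_isCompact_isClosed _
    (fun n => by rw [res_succ]; exact hA.cons_le _ _)
    (fun n => clopens_ne_bot_iff_exists_mem.mp (hA.ne_bot _)) (A _).isClopen.isClosed.isCompact
    fun n => (A _).isClopen.isClosed

theorem exists_forall_mem_res (hA : IsClopenScheme A) (a : X) :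
    ∃ x : ℕ → Bool, ∀ n, a ∈ A (res x n) := by
  have hchild (l : List Bool) : ∃ b, a ∈ A l → a ∈ A (b :: l) := by
    by_contra! h
    rcases hA.sup l ▸ (h true).1 with hmem | hmem
    exacts [(h false).2 hmem, (h true).2 hmem]
  choose next hnext using hchild
  let L : ℕ → List Bool := fun n => n.rec [] fun _ l => next l :: l
  have hres (n : ℕ) : res (fun k => next (L k)) n = L n := by
    induction n with
    | zero => rfl
    | succ n ih => rw [res_succ, ih]
  refine ⟨fun k => next (L k), fun n => hres n ▸ ?_⟩
  induction n with
  | zero => exact hA.nil ▸ trivial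
  | succ n ih => exact hnext _ ih

theorem nonempty_homeomorph [CompactSpace X] [T2Space X] [TotallyDisconnectedSpace X]
    (hA : IsClopenScheme A) : Nonempty ((ℕ → Bool) ≃ₜ X) := by
  let f : (ℕ → Bool) → X := fun x =>
    (CantorScheme.inducedMap fun l => (A l : Set X)).2 ⟨x, hA.iInter_res_nonempty x⟩
  have hf (x : ℕ → Bool) (n : ℕ) : f x ∈ A (res x n) := CantorScheme.map_mem _ n
  have hinj : Function.Injective f := fun x y hxy =>
    congrArg Subtype.val (hA.cantorScheme_disjoint.map_injective hxy)
  have hsurj : Function.Surjective f := by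
    intro a
    obtain ⟨x, hx⟩ := hA.exists_forall_mem_res a
    refine ⟨x, by_contra fun hne => ?_⟩
    obtain ⟨V, hV, haV, hVf⟩ := compact_exists_isClopen_in_isOpen isOpen_ne (Ne.symm hne)
    exact hVf (hA.mem_of_mem_res (V := ⟨V, hV⟩) hx (hf x) haV) rfl
  have hcont : Continuous f := by
    refine loc_compact_Haus_tot_disc_of_zero_dim.continuous_iff.mpr fun V hV => ?_
    refine isOpen_iff_forall_mem_open.mpr fun x hx => ?_
    obtain ⟨n, hn⟩ := hA.decides ⟨V, hV⟩
    have hle : A (res x n) ≤ ⟨V, hV⟩ := (hn _ (res_length x n)).resolve_right fun h =>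
      clopens_ne_bot_iff_exists_mem.mpr ⟨f x, (⟨hf x n, hx⟩ : f x ∈ A (res x n) ⊓ ⟨V, hV⟩)⟩ h.eq_bot
    refine ⟨cylinder x n, fun y hy => ?_, isOpen_cylinder _ x n, self_mem_cylinder x n⟩
    rw [cylinder_eq_res] at hy
    exact hle (hy ▸ hf y n)
  exact ⟨Continuous.homeoOfEquivCompactToT2 (f := Equiv.ofBijective f ⟨hinj, hsurj⟩) hcont⟩

end IsClopenScheme

end Brouwer

/-! ### The Weyl distance -/

/-- A thick building presented by its chambers and its Weyl distance: two chambers at distance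
`s_i` are `i`-adjacent, and `δ x y` is the element of `W` represented by the type of any minimal
gallery from `x` to `y`. -/
structure WeylDistance {B W : Type*} [Group W] {M : CoxeterMatrix B} (cs : CoxeterSystem M W)
    (C : Type*) where
  /-- The Weyl distance. -/
  δ : C → C → W
  eq_one_iff : ∀ x y, δ x y = 1 ↔ x = y
  inv : ∀ x y, δ y x = (δ x y)⁻¹
  step : ∀ c x y i, δ x y = cs.simple i → δ c y = δ c x ∨ δ c y = δ c x * cs.simple i
  step_up : ∀ c x y i, δ x y = cs.simple i →
    cs.length (δ c x) < cs.length (δ c x * cs.simple i) → δ c y = δ c x * cs.simple i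
  exists_step : ∀ c x i, ∃ y, δ x y = cs.simple i ∧ δ c y = δ c x * cs.simple i
  thick : ∀ x i, ∃ y z, y ≠ z ∧ δ x y = cs.simple i ∧ δ x z = cs.simple i

namespace WeylDistance

open CoxeterGroup Set

variable {B W C : Type*} [Group W] {M : CoxeterMatrix B} {cs : CoxeterSystem M W}
  (D : WeylDistance cs C)

/-- Two chambers are `i`-adjacent if they are equal or at distance `s_i`. With this convention
`i`-adjacency is an equivalence relation, whose classes are the `i`-panels. -/
def Adj (i : B) (x y : C) : Prop := x = y ∨ D.δ x y = cs.simple i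

variable {D} {i j k : B} {c d x y z : C} {g w : W} {n : ℕ}

theorem δ_self (x : C) : D.δ x x = 1 := (D.eq_one_iff x x).mpr rfl

theorem ne_of_δ_eq_simple (h : D.δ x y = cs.simple i) : x ≠ y := by
  rintro rfl
  rw [δ_self, eq_comm, ← cs.length_eq_zero_iff, cs.length_simple] at h
  exact one_ne_zero h

theorem Adj.refl (i : B) (x : C) : D.Adj i x x := Or.inl rfl

theorem Adj.symm (h : D.Adj i x y) : D.Adj i y x :=
  h.imp Eq.symm fun h => by rw [D.inv, h, cs.inv_simple]

theorem Adj.trans (hxy : D.Adj i x y) (hyz : D.Adj i y z) : D.Adj i x z := by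
  rcases hyz with rfl | hyz
  · exact hxy
  rcases hxy with rfl | hxy
  · exact Or.inr hyz
  rcases D.step x y z i hyz with hxz | hxz
  · exact Or.inr (hxz.trans hxy)
  · rw [hxy, cs.simple_mul_simple_self] at hxz
    exact Or.inl ((D.eq_one_iff _ _).mp hxz)

theorem exists_adj_ne_ne (i : B) (x z : C) : ∃ y, D.Adj i x y ∧ y ≠ x ∧ y ≠ z := by
  obtain ⟨y, y', hne, hy, hy'⟩ := D.thick x i
  by_cases h : y = z
  · exact ⟨y', Or.inr hy', (ne_of_δ_eq_simple hy').symm, h ▸ hne.symm⟩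
  · exact ⟨y, Or.inr hy, (ne_of_δ_eq_simple hy).symm, h⟩

theorem exists_δ_right (h : D.δ c x = g) (i : B) :
    ∃ y, D.Adj i x y ∧ y ≠ x ∧ D.δ c y = g * cs.simple i := by
  obtain ⟨y, hxy, hcy⟩ := D.exists_step c x i
  exact ⟨y, Or.inr hxy, (ne_of_δ_eq_simple hxy).symm, h ▸ hcy⟩

theorem exists_δ_left (h : D.δ x c = g) (i : B) :
    ∃ y, D.Adj i x y ∧ y ≠ x ∧ D.δ y c = cs.simple i * g := by
  obtain ⟨y, hxy, hne, hcy⟩ := exists_δ_right (D := D) (c := c) (x := x) rfl i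
  exact ⟨y, hxy, hne, by rw [D.inv, hcy, mul_inv_rev, cs.inv_simple, ← D.inv, h]⟩

theorem δ_right_cases (h : D.δ c x = g ∨ D.δ c x = g * cs.simple i) (hxy : D.Adj i x y) :
    D.δ c y = g ∨ D.δ c y = g * cs.simple i := by
  rcases hxy with rfl | hxy
  · exact h
  rcases h with h | h <;> rcases D.step c x y i hxy with hy | hy <;> simp [hy, h]

theorem δ_left_cases (h : D.δ x c = g ∨ D.δ x c = cs.simple i * g) (hxy : D.Adj i x y) :
    D.δ y c = g ∨ D.δ y c = cs.simple i * g := by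
  have h' : D.δ c x = g⁻¹ ∨ D.δ c x = g⁻¹ * cs.simple i :=
    h.imp (fun h => by rw [D.inv, h]) fun h => by rw [D.inv, h, mul_inv_rev, cs.inv_simple]
  exact (δ_right_cases h' hxy).imp (fun h => by rw [D.inv, h, inv_inv])
    fun h => by rw [D.inv, h, mul_inv_rev, cs.inv_simple, inv_inv]

theorem δ_right_eq_of_ne (hg : cs.IsRightDescent g i) (h : D.δ c x = g * cs.simple i)
    (hxy : D.Adj i x y) (hne : y ≠ x) : D.δ c y = g := by
  rcases hxy with rfl | hxy
  · exact absurd rfl hne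
  · have hup := D.step_up c x y i hxy
    rw [h, cs.simple_mul_simple_cancel_right] at hup
    exact hup hg

theorem δ_left_eq_of_ne (hg : cs.IsLeftDescent g i) (h : D.δ x c = cs.simple i * g)
    (hxy : D.Adj i x y) (hne : y ≠ x) : D.δ y c = g := by
  have hx : D.δ c x = g⁻¹ * cs.simple i := by rw [D.inv, h, mul_inv_rev, cs.inv_simple]
  rw [D.inv, δ_right_eq_of_ne (cs.isRightDescent_inv_iff.mpr hg) hx hxy hne, inv_inv]

theorem eq_of_length_δ_right_lt (hg : cs.IsRightDescent g i) (h : D.δ c x = g * cs.simple i)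
    (hxy : D.Adj i x y) (hlt : cs.length (D.δ c y) < cs.length g) : y = x := by
  by_contra hne
  exact hlt.ne (congrArg cs.length (δ_right_eq_of_ne hg h hxy hne))

theorem eq_of_length_δ_left_lt (hg : cs.IsLeftDescent g i) (h : D.δ x c = cs.simple i * g)
    (hxy : D.Adj i x y) (hlt : cs.length (D.δ y c) < cs.length g) : y = x := by
  by_contra hne
  exact hlt.ne (congrArg cs.length (δ_left_eq_of_ne hg h hxy hne))

/-- The chamber `y` is the projection of `c` to the `i`-panel of `x`. -/
theorem existsUnique_δ_right (hg : cs.IsRightDescent g i)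
    (h : D.δ c x = g ∨ D.δ c x = g * cs.simple i) :
    ∃! y, D.Adj i x y ∧ cs.length (D.δ c y) < cs.length g := by
  obtain ⟨y, hxy, hcy⟩ : ∃ y, D.Adj i x y ∧ D.δ c y = g * cs.simple i := by
    rcases h with h | h
    · obtain ⟨y, hxy, -, hcy⟩ := exists_δ_right h i
      exact ⟨y, hxy, hcy⟩
    · exact ⟨x, Adj.refl i x, h⟩
  exact ⟨y, ⟨hxy, hcy ▸ hg⟩,
    fun z hz => eq_of_length_δ_right_lt hg hcy (hxy.symm.trans hz.1) hz.2⟩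

theorem existsUnique_δ_left (hg : cs.IsLeftDescent g i)
    (h : D.δ x c = g ∨ D.δ x c = cs.simple i * g) :
    ∃! y, D.Adj i x y ∧ cs.length (D.δ y c) < cs.length g := by
  obtain ⟨y, hxy, hyc⟩ : ∃ y, D.Adj i x y ∧ D.δ y c = cs.simple i * g := by
    rcases h with h | h
    · obtain ⟨y, hxy, -, hyc⟩ := exists_δ_left h i
      exact ⟨y, hxy, hyc⟩
    · exact ⟨x, Adj.refl i x, h⟩
  exact ⟨y, ⟨hxy, hyc ▸ hg⟩,
    fun z hz => eq_of_length_δ_left_lt hg hyc (hxy.symm.trans hz.1) hz.2⟩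

theorem δ_left_eq_of_length_lt (h : D.δ x c = g ∨ D.δ x c = cs.simple i * g)
    (hxy : D.Adj i x y) (hlt : cs.length (D.δ y c) < cs.length g) :
    D.δ y c = cs.simple i * g :=
  (δ_left_cases h hxy).resolve_left fun he => hlt.ne (congrArg cs.length he)

theorem δ_right_eq_of_length_lt (h : D.δ c x = g ∨ D.δ c x = g * cs.simple i)
    (hxy : D.Adj i x y) (hlt : cs.length (D.δ c y) < cs.length g) :
    D.δ c y = g * cs.simple i :=
  (δ_right_cases h hxy).resolve_left fun he => hlt.ne (congrArg cs.length he)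

theorem exists_δ_eq (c : C) (g : W) : ∃ d, D.δ c d = g := by
  induction g using cs.simple_induction_right with
  | one => exact ⟨c, δ_self c⟩
  | mul_simple_right w i ih =>
    obtain ⟨d, hd⟩ := ih
    obtain ⟨y, -, -, hy⟩ := exists_δ_right hd i
    exact ⟨y, hy⟩

theorem exists_δ_eq' (c : C) (g : W) : ∃ d, D.δ d c = g := by
  obtain ⟨d, hd⟩ := exists_δ_eq (D := D) c g⁻¹
  exact ⟨d, by rw [D.inv, hd, inv_inv]⟩

theorem rel_of_forall_adj {R : C → C → Prop} (hrefl : ∀ x, R x x)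
    (htrans : ∀ x y z, R x y → R y z → R x z) (hadj : ∀ i x y, D.Adj i x y → R x y) (x y : C) :
    R x y := by
  suffices h : ∀ g : W, ∀ y, D.δ x y = g → R x y from h _ y rfl
  intro g
  induction g using cs.simple_induction_right with
  | one => exact fun y hy => (D.eq_one_iff _ _).mp hy ▸ hrefl x
  | mul_simple_right w i ih =>
    intro y hy
    obtain ⟨z, hyz, -, hxz⟩ := exists_δ_right hy i
    rw [cs.simple_mul_simple_cancel_right] at hxz
    exact htrans _ _ _ (ih z hxz) (hadj i _ _ hyz.symm)

section RankTwo

variable {i' j' : B}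

theorem δ_right_eq_of_rankTwo (h : RankTwo cs i j i' j' w) (hc : D.δ c x = cs.simple i * w)
    (hxy : D.Adj i' x y) (hne : y ≠ x) : D.δ c y = w :=
  δ_right_eq_of_ne h.isRightDescent (hc.trans h.fst_mul) hxy hne

theorem δ_right_eq_simple_mul_of_rankTwo (h : RankTwo cs i j i' j' w)
    (hc : D.δ c x = cs.simple j * (cs.simple i * w)) (hxy : D.Adj i' x y) (hne : y ≠ x) :
    D.δ c y = cs.simple j * w :=
  δ_right_eq_of_ne h.isRightDescent_simple_mul (by rw [hc, h.fst_mul, mul_assoc]) hxy hne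

theorem δ_right_eq_simple_mul_simple_mul_of_rankTwo (h : RankTwo cs i j i' j' w)
    (hc : D.δ c x = cs.simple i * (cs.simple j * (cs.simple i * w))) (hxy : D.Adj i' x y)
    (hne : y ≠ x) : D.δ c y = cs.simple i * (cs.simple j * w) :=
  δ_right_eq_of_ne h.isRightDescent_simple_mul_simple_mul (by simp only [hc, h.fst_mul, mul_assoc])
    hxy hne

theorem exists_δ_right_of_rankTwo (h : RankTwo cs i j i' j' w) (hc : D.δ c x = w) :
    ∃ y, D.Adj i' x y ∧ y ≠ x ∧ D.δ c y = cs.simple i * w :=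
  h.fst_mul ▸ exists_δ_right hc i'

theorem eq_of_length_δ_right_lt_of_rankTwo (h : RankTwo cs i j i' j' w)
    (hc : D.δ c x = cs.simple i * w) (hxy : D.Adj i' x y)
    (hlt : cs.length (D.δ c y) < cs.length w) : y = x :=
  eq_of_length_δ_right_lt h.isRightDescent (hc.trans h.fst_mul) hxy hlt

end RankTwo

variable (D) in
/-- A property of pairs consisting of a panel and a chamber in it (given by the type of the panel
and the chamber) that is preserved by projection between opposite panels of residues. -/
def PerspectivityInvariant (S : B → C → Prop) : Prop :=
  ∀ ⦃i k : B⦄ ⦃w : W⦄ ⦃c d : C⦄, cs.simple i * w = w * cs.simple k → cs.IsLeftDescent w i →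
    D.δ c d = cs.simple i * w → (S i c ↔ S k d)

namespace PerspectivityInvariant

variable {S : B → C → Prop}

theorem iff_of_rankTwo (hS : D.PerspectivityInvariant S) {i' j' : B}
    (h : RankTwo cs i j i' j' w) (hcd : D.δ c d = cs.simple i * w) : S i c ↔ S i' d :=
  hS h.fst_mul h.isLeftDescent hcd

theorem iff_of_adj_of_not_commute [Finite W] (hS : D.PerspectivityInvariant S)
    (hij : ¬ Commute (cs.simple i) (cs.simple j)) (hcd : D.Adj j c d) : S i c ↔ S i d := by
  obtain ⟨i', j', w, h⟩ := exists_rankTwo hij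
  obtain ⟨e, hce, hec, hed⟩ := exists_adj_ne_ne (D := D) j c d
  obtain ⟨f, hef⟩ := exists_δ_eq (D := D) e (cs.simple j * (cs.simple i * w))
  have hcf := δ_left_eq_of_ne h.symm.isLeftDescent_simple_mul hef hce.symm hec.symm
  have hdf := δ_left_eq_of_ne h.symm.isLeftDescent_simple_mul hef (hce.symm.trans hcd) hed.symm
  exact (hS.iff_of_rankTwo h hcf).trans (hS.iff_of_rankTwo h hdf).symm

theorem iff_of_adj_self [Finite W] (hS : D.PerspectivityInvariant S)
    (hij : ¬ Commute (cs.simple i) (cs.simple j)) (hcd : D.Adj i c d) : S i c ↔ S i d := by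
  obtain ⟨i', j', w, h⟩ := exists_rankTwo hij
  obtain ⟨e, hce, hec, hed⟩ := exists_adj_ne_ne (D := D) i c d
  obtain ⟨f, hef⟩ := exists_δ_eq (D := D) e (cs.simple i * (cs.simple j * (cs.simple i * w)))
  have hiff (x : C) (hex : D.Adj i e x) (hxe : x ≠ e) : S i x ↔ S i' f := by
    have hxf := δ_left_eq_of_ne h.symm.isLeftDescent_simple_mul_simple_mul hef hex hxe
    obtain ⟨y, hxy, hyx, -⟩ := exists_adj_ne_ne (D := D) j x x
    exact (hS.iff_of_adj_of_not_commute hij hxy).trans <|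
      hS.iff_of_rankTwo h (δ_left_eq_of_ne h.symm.isLeftDescent_simple_mul hxf hxy hyx)
  exact (hiff c hce.symm hec.symm).trans (hiff d (hce.symm.trans hcd) hed.symm).symm

theorem iff_of_adj_of_commute (hS : D.PerspectivityInvariant S)
    (hij : Commute (cs.simple i) (cs.simple j)) (hne : cs.simple i ≠ cs.simple j)
    (hcd : D.Adj j c d) : S i c ↔ S i d := by
  rcases hcd with rfl | hcd
  · rfl
  refine hS (w := cs.simple i * cs.simple j) ?_ ?_
    (by rw [hcd, cs.simple_mul_simple_cancel_left])
  · rw [cs.simple_mul_simple_cancel_left, hij.eq, cs.simple_mul_simple_cancel_right]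
  · rw [CoxeterSystem.IsLeftDescent, cs.simple_mul_simple_cancel_left,
      length_simple_mul_simple_of_ne hne, cs.length_simple]
    exact one_lt_two

theorem iff [Finite W] (hS : D.PerspectivityInvariant S)
    (hirr : ∀ i : B, ∃ j, ¬ Commute (cs.simple i) (cs.simple j)) (i : B) (c d : C) :
    S i c ↔ S i d := by
  refine rel_of_forall_adj (D := D) (R := fun c d => S i c ↔ S i d) (fun _ => Iff.rfl)
    (fun _ _ _ => Iff.trans) (fun k x y hxy => ?_) c d
  by_cases hcomm : Commute (cs.simple i) (cs.simple k)
  · by_cases hki : cs.simple k = cs.simple i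
    · obtain ⟨j, hij⟩ := hirr i
      exact hS.iff_of_adj_self hij (by rwa [Adj, ← hki])
    · exact hS.iff_of_adj_of_commute hcomm (Ne.symm hki) hxy
  · exact hS.iff_of_adj_of_not_commute hcomm hxy

end PerspectivityInvariant

variable (D) in
/-- The `i`-panel containing a chamber, as a set of chambers. -/
def panel (i : B) (c : C) : Set C := {d | D.Adj i c d}

theorem mem_panel_self (i : B) (c : C) : c ∈ D.panel i c := Adj.refl i c

variable (D) in
/-- The chamber `c` as a point of its `i`-panel. -/
abbrev panelPoint (i : B) (c : C) : D.panel i c := ⟨c, mem_panel_self i c⟩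

theorem panel_eq (h : d ∈ D.panel i c) : D.panel i d = D.panel i c :=
  Set.ext fun _ => ⟨Adj.trans h, Adj.trans (Adj.symm h)⟩

theorem length_δ_le_succ (h : D.Adj i x y) : cs.length (D.δ c y) ≤ cs.length (D.δ c x) + 1 := by
  have hlen := cs.length_mul_simple (D.δ c x) i
  rcases δ_right_cases (Or.inl rfl) h with hy | hy <;> rw [hy] <;> omega

variable (D) in
/-- The chambers that can be reached from a given chamber by a gallery of length at most `n`. -/
def ball (c : C) (n : ℕ) : Set C := {d | cs.length (D.δ c d) ≤ n}

theorem mem_ball : d ∈ D.ball c n ↔ cs.length (D.δ c d) ≤ n := Iff.rfl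

theorem mem_ball_zero : d ∈ D.ball c 0 ↔ c = d := by
  rw [mem_ball, nonpos_iff_eq_zero, cs.length_eq_zero_iff, D.eq_one_iff]

theorem mem_ball_succ :
    d ∈ D.ball c (n + 1) ↔ d ∈ D.ball c n ∨ ∃ i, ∃ z ∈ D.ball c n, D.Adj i z d := by
  simp only [mem_ball]
  constructor
  · intro hd
    refine or_iff_not_imp_left.mpr fun hn => ?_
    have hne : D.δ c d ≠ 1 := fun heq => hn (by simp [heq])
    obtain ⟨i, hi⟩ := cs.exists_rightDescent_of_ne_one hne
    obtain ⟨z, hdz, -, hcz⟩ := exists_δ_right (D := D) rfl i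
    have hlen := cs.isRightDescent_iff.mp hi
    exact ⟨i, z, by rw [hcz]; omega, hdz.symm⟩
  · rintro (hd | ⟨i, z, hz, hzd⟩)
    · exact hd.trans n.le_succ
    · exact (length_δ_le_succ hzd).trans (Nat.succ_le_succ hz)

theorem exists_ball_eq_univ [Finite W] (D : WeylDistance cs C) (c : C) :
    ∃ n, D.ball c n = univ := by
  obtain ⟨n, hn⟩ := (Set.finite_range cs.length).bddAbove
  exact ⟨n, eq_univ_of_forall fun d => hn ⟨_, rfl⟩⟩

end WeylDistance

namespace WeylDistance

open CoxeterGroup Set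

variable {B W C : Type*} [Group W] {M : CoxeterMatrix B} {cs : CoxeterSystem M W}
  {D : WeylDistance cs C} {i k : B} {c d : C} {g w : W} [TopologicalSpace C]

variable (D) in
/-- The topology on the set of chambers is compatible with the Weyl distance in the sense that the
adjacency relation of every type is closed. -/
def ClosedAdj : Prop := ∀ i, IsClosed {p : C × C | D.Adj i p.1 p.2}

namespace ClosedAdj

variable {X : Type*} [TopologicalSpace X] {f f' : X → C}

theorem isClosed (hD : D.ClosedAdj) (i : B) (hf : Continuous f) (hf' : Continuous f') :
    IsClosed {x | D.Adj i (f x) (f' x)} :=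
  (hD i).preimage (hf.prodMk hf')

theorem isClosed_panel (hD : D.ClosedAdj) (i : B) (c : C) : IsClosed (D.panel i c) :=
  hD.isClosed i continuous_const continuous_id

theorem compactSpace_panel [CompactSpace C] (hD : D.ClosedAdj) (i : B) (c : C) :
    CompactSpace (D.panel i c) :=
  isCompact_iff_compactSpace.mp (hD.isClosed_panel i c).isCompact

variable [Finite B] [CompactSpace C] [T2Space C]

theorem isClosed_mem_ball (hD : D.ClosedAdj) (n : ℕ) (hf : Continuous f) (hf' : Continuous f') :
    IsClosed {x | f' x ∈ D.ball (f x) n} := by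
  suffices h : IsClosed {p : C × C | p.2 ∈ D.ball p.1 n} from h.preimage (hf.prodMk hf')
  induction n with
  | zero =>
    simp only [mem_ball_zero]
    exact isClosed_eq continuous_fst continuous_snd
  | succ n ih =>
    simp only [mem_ball_succ, ofPred_or, ofPred_exists]
    refine ih.union (isClosed_iUnion_of_finite fun i => ?_)
    have hball : IsClosed {q : (C × C) × C | q.2 ∈ D.ball q.1.1 n} :=
      ih.preimage (f := fun q : (C × C) × C => (q.1.1, q.2)) (by fun_prop)
    simpa only [← ofPred_exists] using
      isClosed_setOf_exists (hball.and (hD.isClosed i (by fun_prop) (by fun_prop)))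

theorem isClosed_length_lt (hD : D.ClosedAdj) (n : ℕ) (hf : Continuous f) (hf' : Continuous f') :
    IsClosed {x | cs.length (D.δ (f x) (f' x)) < n} := by
  cases n with
  | zero => simp
  | succ n =>
    simp only [Nat.lt_succ_iff, ← mem_ball]
    exact hD.isClosed_mem_ball n hf hf'

theorem isOpen_δ_eq (hD : D.ClosedAdj) (hw : IsLongest cs univ w) (hf : Continuous f)
    (hf' : Continuous f') : IsOpen {x | D.δ (f x) (f' x) = w} := by
  have hcompl : {x | D.δ (f x) (f' x) = w} = {x | cs.length (D.δ (f x) (f' x)) < cs.length w}ᶜ := by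
    ext x
    exact ⟨fun h => (congrArg cs.length h).not_lt, fun h => hw.eq_of_length_le (not_lt.mp h)⟩
  rw [hcompl, isOpen_compl_iff]
  exact hD.isClosed_length_lt _ hf hf'

/-- Two panels that are opposite in a residue are homeomorphic by projection. -/
theorem exists_homeomorph (hD : D.ClosedAdj) (hw : cs.simple i * w = w * cs.simple k)
    (hi : cs.IsLeftDescent w i) (hcd : D.δ c d = cs.simple i * w) :
    ∃ e : D.panel i c ≃ₜ D.panel k d, e (D.panelPoint i c) = D.panelPoint k d := by
  have := hD.compactSpace_panel i c
  have := hD.compactSpace_panel k d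
  have hk : cs.IsRightDescent w k := by rwa [CoxeterSystem.IsRightDescent, ← hw]
  have hright (x : D.panel i c) :
      ∃! y : D.panel k d, cs.length (D.δ x.1 y.1) < cs.length w := by
    have hx := δ_left_cases (Or.inr hcd) x.2
    obtain ⟨y, hy, hyu⟩ := existsUnique_δ_right hk (hw ▸ hx)
    exact ⟨⟨y, hy.1⟩, hy.2, fun z hz => Subtype.ext (hyu z ⟨z.2, hz⟩)⟩
  have hleft (y : D.panel k d) :
      ∃! x : D.panel i c, cs.length (D.δ x.1 y.1) < cs.length w := by
    have hy := δ_right_cases (Or.inr (hcd.trans hw)) y.2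
    obtain ⟨x, hx, hxu⟩ := existsUnique_δ_left hi (hw ▸ hy)
    exact ⟨⟨x, hx.1⟩, hx.2, fun z hz => Subtype.ext (hxu z ⟨z.2, hz⟩)⟩
  obtain ⟨e, he⟩ := exists_homeomorph_of_isClosed_rel
    (hD.isClosed_length_lt _ (by fun_prop) (by fun_prop)) hright hleft
  refine ⟨e, Subtype.ext ?_⟩
  exact eq_of_length_δ_right_lt hk (hcd.trans hw) (e _).2 (he (D.panelPoint i c))

end ClosedAdj

theorem preconnectedSpace_of_panels (hp : ∀ i c, IsPreconnected (D.panel i c)) :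
    PreconnectedSpace C := by
  have heq (x y : C) : connectedComponent x = connectedComponent y :=
    rel_of_forall_adj (D := D) (R := fun x y => connectedComponent x = connectedComponent y)
      (fun _ => rfl) (fun _ _ _ => Eq.trans) (fun i x y hxy => connectedComponent_eq <|
        (hp i x).subset_connectedComponent (mem_panel_self i x) hxy) x y
  exact preconnectedSpace_iff_connectedComponent.mpr fun x =>
    eq_univ_of_forall fun y => heq x y ▸ mem_connectedComponent

namespace ClosedAdj

variable [Finite B] [CompactSpace C] [T2Space C]

theorem isTotallyDisconnected_δ_eq (hD : D.ClosedAdj)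
    (hp : ∀ i c, IsTotallyDisconnected (D.panel i c)) (c : C) (g : W) :
    IsTotallyDisconnected {d | D.δ c d = g} := by
  induction hn : cs.length g generalizing g c with
  | zero =>
    rw [cs.length_eq_zero_iff] at hn
    subst hn
    intro K hK _ x hx y hy
    exact ((D.eq_one_iff c x).mp (hK hx)).symm.trans ((D.eq_one_iff c y).mp (hK hy))
  | succ n ih =>
    intro K hKg hK x hx y hy
    obtain ⟨i, hi⟩ := cs.exists_leftDescent_of_ne_one (w := g) (by rintro rfl; simp at hn)
    have hex : ∀ d ∈ K, ∃! z, D.Adj i c z ∧ cs.length (D.δ z d) < cs.length g :=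
      fun d hd => existsUnique_δ_left hi (Or.inl (hKg hd))
    have hproj : {z | ∃ d ∈ K, D.Adj i c z ∧ cs.length (D.δ z d) < cs.length g}.Subsingleton :=
      hp i c _ (fun z hz => hz.choose_spec.2.1) <| isPreconnected_setOf_exists_mem_rel
        ((hD.isClosed i (by fun_prop) (by fun_prop)).and
          (hD.isClosed_length_lt _ (by fun_prop) (by fun_prop))) hK hex
    obtain ⟨z, hz, -⟩ := hex x hx
    refine ih z (cs.simple i * g) (by have := cs.isLeftDescent_iff.mp hi; omega) K ?_ hK hx hy
    intro d hd
    obtain ⟨z', hz', -⟩ := hex d hd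
    rw [hproj ⟨x, hx, hz⟩ ⟨d, hd, hz'⟩]
    exact δ_left_eq_of_length_lt (Or.inl (hKg hd)) hz'.1 hz'.2

theorem totallyDisconnectedSpace_of_panels [Finite W] (hD : D.ClosedAdj)
    (hp : ∀ i c, IsTotallyDisconnected (D.panel i c)) : TotallyDisconnectedSpace C := by
  refine totallyDisconnectedSpace_of_isOpen_cover fun d => ?_
  obtain ⟨w, hw⟩ := exists_isLongest cs univ
  obtain ⟨c, hc⟩ := exists_δ_eq' (D := D) d w
  exact ⟨{d | D.δ c d = w}, hD.isOpen_δ_eq hw continuous_const continuous_id, hc,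
    hD.isTotallyDisconnected_δ_eq hp c w⟩

end ClosedAdj

end WeylDistance

/-! ### Connected panels -/

namespace WeylDistance

open CoxeterGroup Set

universe u

variable {B W : Type*} {C : Type u} [Group W] {M : CoxeterMatrix B} {cs : CoxeterSystem M W}
  {D : WeylDistance cs C} {i j k i' j' : B} {a b c d e p x x' y y' z : C} {w : W}

/-- In other words, `e` projects to `c`, `y` and `y'` in their panels of types `i`, `j` and `j`. -/
theorem exists_δ_eq_of_gallery (h : RankTwo cs i j i' j' w) (hxy : D.Adj j x y) (hyx : y ≠ x)
    (hx : D.Adj i c x) (hxc : x ≠ c) (hx' : D.Adj i c x') (hxc' : x' ≠ c) (hne : x ≠ x')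
    (hxy' : D.Adj j x' y') (hyx' : y' ≠ x') :
    ∃ e, D.δ c e = cs.simple i * w ∧ D.δ y e = cs.simple j * w ∧ D.δ y' e = cs.simple j * w := by
  have hxx' : D.Adj i x' x := hx'.symm.trans hx
  obtain ⟨k, hyk'⟩ := exists_δ_eq (D := D) y' (cs.simple j * (cs.simple i * (cs.simple j * w)))
  have hxk' := δ_left_eq_of_ne h.isLeftDescent_simple_mul_simple_mul hyk' hxy'.symm hyx'.symm
  have hxk := δ_left_eq_of_ne h.isLeftDescent_simple_mul hxk' hxx' hne
  have hyk := δ_left_eq_of_ne h.symm.isLeftDescent hxk hxy hyx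
  obtain ⟨m, hkm, hmk, hym⟩ := exists_δ_right_of_rankTwo h.symm hyk
  have hym' := δ_right_eq_simple_mul_simple_mul_of_rankTwo h.symm hyk' hkm hmk
  have hxm' := δ_left_eq_of_ne h.symm.isLeftDescent_simple_mul hym' hxy'.symm hyx'.symm
  have hcm := δ_left_eq_of_ne h.isLeftDescent hxm' hx'.symm hxc'.symm
  obtain ⟨e, hme, hem, hce⟩ := exists_δ_right_of_rankTwo h hcm
  refine ⟨e, hce, ?_, δ_right_eq_simple_mul_of_rankTwo h hym' hme hem⟩
  refine (δ_right_cases (Or.inl hym) hme).resolve_right fun hye => hxc ?_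
  rw [mul_assoc, ← h.fst_mul] at hye
  have hxe := δ_left_eq_of_ne h.symm.isLeftDescent_simple_mul hye hxy.symm hyx.symm
  exact eq_of_length_δ_left_lt h.isLeftDescent hce hx (hxe ▸ h.isLeftDescent)

variable (D) in
/-- The chamber `p` is the projection to the `j'`-panel of `d` of the projection of `e` to the
`j`-panel of `z`. Here two panels of types `j` and `j'` are understood to be opposite in a residue
whose longest element is `w`. -/
def IsDoubleProj (j j' : B) (w : W) (d e z p : C) : Prop :=
  ∃ y, D.Adj j z y ∧ cs.length (D.δ y e) < cs.length w ∧
    D.Adj j' d p ∧ cs.length (D.δ y p) < cs.length w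

theorem existsUnique_isDoubleProj (h : RankTwo cs i j i' j' w)
    (hcd : D.δ c d = cs.simple i * (cs.simple j * w)) (hce : D.δ c e = cs.simple i * w)
    (hz : D.Adj i c z) (hzc : z ≠ c) : ∃! p, D.IsDoubleProj j j' w d e z p := by
  have hze := δ_left_eq_of_ne h.isLeftDescent hce hz hzc
  have hzd := δ_left_eq_of_ne h.isLeftDescent_simple_mul hcd hz hzc
  obtain ⟨y, hzy, hyz, hye⟩ := exists_δ_left hze j
  have hyd := δ_left_eq_of_ne h.symm.isLeftDescent hzd hzy hyz
  obtain ⟨p, hdp, -, hyp⟩ := exists_δ_right_of_rankTwo h.symm hyd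
  refine ⟨p, ⟨y, hzy, hye ▸ h.symm.isLeftDescent, hdp, hyp ▸ h.symm.isLeftDescent⟩, ?_⟩
  rintro p' ⟨y', hzy', hye', hdp', hyp'⟩
  obtain rfl := eq_of_length_δ_left_lt h.symm.isLeftDescent hye (hzy.symm.trans hzy') hye'
  exact eq_of_length_δ_right_lt_of_rankTwo h.symm hyp (hdp.symm.trans hdp') hyp'

variable [TopologicalSpace C] [CompactSpace C]

namespace ClosedAdj

theorem perspectivityInvariant [Finite B] [T2Space C] (hD : D.ClosedAdj)
    (P : ∀ {X : Type u} [TopologicalSpace X], X → Prop)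
    (hP : ∀ {X Y : Type u} [TopologicalSpace X] [TopologicalSpace Y] {x : X} (e : X ≃ₜ Y),
      P x → P (e x)) : D.PerspectivityInvariant fun i c => P (D.panelPoint i c) := by
  intro i k w c d hw hi hcd
  obtain ⟨e, he⟩ := hD.exists_homeomorph hw hi hcd
  refine ⟨fun h => ?_, fun h => ?_⟩
  · simpa only [he] using hP e h
  · simpa only [← he, e.symm_apply_apply] using hP e.symm h

theorem exists_hasPuncturedContinuum_panelPoint [T2Space C] (hD : D.ClosedAdj)
    (h : ¬ IsTotallyDisconnected (D.panel i c)) :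
    ∃ d, HasPuncturedContinuum (D.panelPoint i d) := by
  have := hD.compactSpace_panel i c
  obtain ⟨⟨d, hd⟩, hdP⟩ := exists_hasPuncturedContinuum (X := D.panel i c)
    (mt totallyDisconnectedSpace_subtype_iff.mp h)
  exact ⟨d, hdP.map_homeomorph (Homeomorph.setCongr (panel_eq hd).symm)⟩

variable [Finite B] [T2Space C]

theorem isClosed_isDoubleProj {X : Type*} [TopologicalSpace X] {f g q : X → C}
    (hD : D.ClosedAdj) (j j' : B) (w : W) (d : C) (hf : Continuous f) (hg : Continuous g)
    (hq : Continuous q) : IsClosed {t | D.IsDoubleProj j j' w d (f t) (g t) (q t)} :=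
  isClosed_setOf_exists <| (hD.isClosed j (by fun_prop) (by fun_prop)).and <|
    (hD.isClosed_length_lt _ (by fun_prop) (by fun_prop)).and <|
    (hD.isClosed j' (by fun_prop) (by fun_prop)).and
    (hD.isClosed_length_lt _ (by fun_prop) (by fun_prop))

theorem exists_isPreconnected_mem_mem (hD : D.ClosedAdj) (h : RankTwo cs i j i' j' w)
    (hS : ∀ c, HasPuncturedContinuum (D.panelPoint i c)) (ha : D.Adj j' d a) (had : a ≠ d)
    (hb : D.Adj j' d b) (hbd : b ≠ d) :
    ∃ K ⊆ D.panel j' d, a ∈ K ∧ b ∈ K ∧ IsPreconnected K := by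
  obtain ⟨c, hcd⟩ := exists_δ_eq' (D := D) d (cs.simple i * (cs.simple j * w))
  obtain ⟨K, hK, ⟨⟨x, hx⟩, hxK, ⟨x', hx'⟩, hxK', hne⟩, hcK⟩ := hS c
  have hKc : ∀ z ∈ K, z.1 ≠ c := fun z hz hzc => hcK ((Subtype.ext hzc : z = D.panelPoint i c) ▸ hz)
  have exists_proj (x : C) (hx : D.Adj i c x) (hxc : x ≠ c) (a : C) (ha : D.Adj j' d a)
      (had : a ≠ d) : ∃ y, D.Adj j x y ∧ y ≠ x ∧ D.δ y a = cs.simple j * w := by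
    have hxd := δ_left_eq_of_ne h.isLeftDescent_simple_mul hcd hx hxc
    exact exists_δ_left (δ_right_eq_of_rankTwo h.symm hxd ha had) j
  obtain ⟨y, hxy, hyx, hya⟩ := exists_proj x hx (hKc _ hxK) a ha had
  obtain ⟨y', hxy', hyx', hyb⟩ := exists_proj x' hx' (hKc _ hxK') b hb hbd
  obtain ⟨e, hce, hye, hye'⟩ := exists_δ_eq_of_gallery h hxy hyx hx (hKc _ hxK) hx' (hKc _ hxK')
    (fun h => hne (Subtype.ext h)) hxy' hyx'
  have hlt : cs.length (cs.simple j * w) < cs.length w := h.symm.isLeftDescent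
  refine ⟨{p | ∃ z ∈ Subtype.val '' K, D.IsDoubleProj j j' w d e z p}, ?_,
    ⟨x, ⟨_, hxK, rfl⟩, y, hxy, hye ▸ hlt, ha, hya ▸ hlt⟩,
    ⟨x', ⟨_, hxK', rfl⟩, y', hxy', hye' ▸ hlt, hb, hyb ▸ hlt⟩,
    isPreconnected_setOf_exists_mem_rel (hD.isClosed_isDoubleProj j j' w d continuous_const
      continuous_fst continuous_snd) (hK.image _ continuous_subtype_val.continuousOn) ?_⟩
  · rintro p ⟨z, -, y, -, -, hp, -⟩
    exact hp
  · rintro _ ⟨z, hz, rfl⟩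
    exact existsUnique_isDoubleProj h hcd hce z.2 (hKc z hz)

theorem isPreconnected_panel_of_rankTwo (hD : D.ClosedAdj) (h : RankTwo cs i j i' j' w)
    (hS : ∀ c, HasPuncturedContinuum (D.panelPoint i c)) (d : C) :
    IsPreconnected (D.panel j' d) := by
  refine isPreconnected_of_forall_pair fun a ha b hb => ?_
  obtain ⟨d', hd', hda, hdb⟩ := exists_adj_ne_ne (D := D) j' a b
  rw [← panel_eq (Adj.trans ha hd')]
  exact hD.exists_isPreconnected_mem_mem h hS hd'.symm hda.symm
    (hd'.symm.trans ((Adj.symm ha).trans hb)) hdb.symm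

theorem isPreconnected_panel_of_not_commute (hD : D.ClosedAdj) [Finite W]
    (hij : ¬ Commute (cs.simple i) (cs.simple j))
    (hS : ∀ c, HasPuncturedContinuum (D.panelPoint i c)) (c : C) :
    IsPreconnected (D.panel j c) := by
  obtain ⟨i', j', w, h⟩ := exists_rankTwo hij
  obtain ⟨d, hd⟩ := exists_δ_eq (D := D) c (cs.simple j * w)
  obtain ⟨e, -⟩ := hD.exists_homeomorph h.snd_mul h.symm.isLeftDescent hd
  have := isPreconnected_iff_preconnectedSpace.mp (hD.isPreconnected_panel_of_rankTwo h hS d)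
  exact isPreconnected_iff_preconnectedSpace.mpr <|
    e.symm.surjective.denseRange.preconnectedSpace e.symm.continuous

theorem forall_hasPuncturedContinuum (hD : D.ClosedAdj) [Finite W] [Nontrivial B]
    (hirr : cs.IsIrreducible) (hp : ¬ IsTotallyDisconnected (D.panel i c)) (k : B) (d : C) :
    HasPuncturedContinuum (D.panelPoint k d) := by
  have hirr' := exists_not_commute_of_isIrreducible hirr
  have hpersp := hD.perspectivityInvariant HasPuncturedContinuum fun e h => h.map_homeomorph e
  obtain ⟨c', hc'⟩ := hD.exists_hasPuncturedContinuum_panelPoint hp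
  let J : Set B := {k | ∀ d, HasPuncturedContinuum (D.panelPoint k d)}
  have hi : i ∈ J := fun d => (hpersp.iff hirr' i c' d).mp hc'
  by_contra hk
  obtain ⟨a, ha, b, hb, hab⟩ := hirr J ⟨i, hi⟩ ⟨k, fun h => hk (h d)⟩
  refine hb fun d => ?_
  have := hD.compactSpace_panel b d
  have := isPreconnected_iff_preconnectedSpace.mp (hD.isPreconnected_panel_of_not_commute hab ha d)
  obtain ⟨y, hy, hyd, -⟩ := exists_adj_ne_ne (D := D) b d d
  have : Nontrivial (D.panel b d) :=
    ⟨D.panelPoint b d, ⟨y, hy⟩, fun h => hyd (congrArg Subtype.val h).symm⟩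
  exact exists_isPreconnected_nontrivial_notMem _

theorem preconnectedSpace_or_totallyDisconnectedSpace (hD : D.ClosedAdj) [Finite W] [Nontrivial B]
    (hirr : cs.IsIrreducible) : PreconnectedSpace C ∨ TotallyDisconnectedSpace C := by
  by_cases hp : ∀ i c, IsTotallyDisconnected (D.panel i c)
  · exact Or.inr (hD.totallyDisconnectedSpace_of_panels hp)
  push Not at hp
  obtain ⟨i, c, hic⟩ := hp
  refine Or.inl (preconnectedSpace_of_panels (D := D) fun k d => ?_)
  obtain ⟨j, hkj⟩ := exists_not_commute_of_isIrreducible hirr k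
  exact hD.isPreconnected_panel_of_not_commute (fun h => hkj h.symm)
    (hD.forall_hasPuncturedContinuum hirr hic j) d

end ClosedAdj

end WeylDistance

namespace WeylDistance

open CoxeterGroup Set

variable {B W C : Type*} [Group W] {M : CoxeterMatrix B} {cs : CoxeterSystem M W}
  {D : WeylDistance cs C} {i j i' j' : B} {b c d m x y : C} {w w₀ : W} {n : ℕ}

variable (D) in
/-- Some chamber of the `j`-panel of `x` other than `x` itself has a Weyl distance of length less
than `n` to some chamber of the `i'`-panel of `b`. -/
def IsNear (j i' : B) (n : ℕ) (x b : C) : Prop :=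
  ∃ s, D.Adj i' b s ∧ ∃ y ∈ D.panel j x \ {x}, cs.length (D.δ y s) < n

theorem isNear_of_δ_eq (h : RankTwo cs i j i' j' w) (hxb : D.δ x b = w) :
    D.IsNear j i' (cs.length (cs.simple i * w)) x b := by
  obtain ⟨y, hxy, hyx, hyb⟩ := exists_δ_left hxb j
  obtain ⟨s, hbs, -, hys⟩ := exists_δ_right hyb i'
  rw [mul_assoc, ← h.fst_mul] at hys
  exact ⟨s, hbs, y, ⟨hxy, hyx⟩, hys ▸ h.symm.isLeftDescent_simple_mul⟩

theorem not_isNear_of_δ_eq (h : RankTwo cs i j i' j' w)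
    (hxm : D.δ x m = cs.simple j * (cs.simple i * w)) :
    ¬ D.IsNear j i' (cs.length (cs.simple i * w)) x m := by
  rintro ⟨s, hms, y, ⟨hxy, hyx⟩, hlt⟩
  have hym := δ_left_eq_of_ne h.symm.isLeftDescent_simple_mul hxm hxy hyx
  rcases δ_right_cases (Or.inr (hym.trans h.fst_mul)) hms with hys | hys
  · exact lt_asymm h.isLeftDescent (hys ▸ hlt)
  · exact hlt.ne (by rw [hys, h.fst_mul])

theorem finite_of_panels [Finite W] [Finite B] (h : ∀ i c, (D.panel i c).Finite) : Finite C := by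
  rcases isEmpty_or_nonempty C with hC | ⟨⟨c⟩⟩
  · infer_instance
  have hball (n : ℕ) : (D.ball c n).Finite := by
    induction n with
    | zero => exact (finite_singleton c).subset fun d hd => (mem_ball_zero.mp hd).symm
    | succ n ih =>
      refine (ih.union (finite_iUnion fun i => ih.biUnion fun z _ => h i z)).subset fun d hd => ?_
      refine (mem_ball_succ.mp hd).imp_right ?_
      rintro ⟨i, z, hz, hzd⟩
      exact mem_iUnion.mpr ⟨i, mem_biUnion hz hzd⟩
  obtain ⟨n, hn⟩ := D.exists_ball_eq_univ c
  exact finite_univ_iff.mp (hn ▸ hball n)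

variable [TopologicalSpace C] [CompactSpace C]

namespace ClosedAdj

theorem exists_isCountableAccPt_panelPoint (hD : D.ClosedAdj) (h : (D.panel i c).Infinite) :
    ∃ d, IsCountableAccPt (D.panelPoint i d) := by
  have := hD.compactSpace_panel i c
  have := h.to_subtype
  obtain ⟨⟨d, hd⟩, hacc⟩ := exists_isCountableAccPt (X := D.panel i c)
  exact ⟨d, hacc.map_homeomorph (Homeomorph.setCongr (panel_eq hd).symm)⟩

variable [T2Space C] [Finite B]

theorem perspectivityInvariant_isCountableAccPt (hD : D.ClosedAdj) :
    D.PerspectivityInvariant fun i c => IsCountableAccPt (D.panelPoint i c) :=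
  hD.perspectivityInvariant IsCountableAccPt fun e h => h.map_homeomorph e

theorem isCountableAccPt_of_rankTwo (hD : D.ClosedAdj) (h : RankTwo cs i j i' j' w)
    (hi : ∀ c, IsCountableAccPt (D.panelPoint i c)) (d : C) :
    IsCountableAccPt (D.panelPoint i' d) := by
  obtain ⟨c, hcd⟩ := exists_δ_eq' (D := D) d (cs.simple i * w)
  exact (hD.perspectivityInvariant_isCountableAccPt.iff_of_rankTwo h hcd).mp (hi c)

theorem isClosed_isNear_proj (hD : D.ClosedAdj) (hfin : (D.panel j x).Finite) (k : C) :
    IsClosed {a | ∃ b, (D.Adj j' a b ∧ cs.length (D.δ b k) < cs.length w₀) ∧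
      D.IsNear j i' n x b} := by
  have hclosed : IsClosed (D.panel j x \ {x}) := (hfin.subset sdiff_subset).isClosed
  have hnear : IsClosed {b | D.IsNear j i' n x b} :=
    isClosed_setOf_exists <| (hD.isClosed i' (by fun_prop) (by fun_prop)).and <|
      isClosed_setOf_exists <| (hclosed.preimage (by fun_prop)).and <|
      hD.isClosed_length_lt _ (by fun_prop) (by fun_prop)
  exact isClosed_setOf_exists <| ((hD.isClosed j' (by fun_prop) (by fun_prop)).and
    (hD.isClosed_length_lt _ (by fun_prop) (by fun_prop))).and (hnear.preimage (by fun_prop))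

theorem infinite_panel (hD : D.ClosedAdj) [Finite W] (h : RankTwo cs i j i' j' w)
    (hi : ∀ c, IsCountableAccPt (D.panelPoint i c)) (x : C) : (D.panel j x).Infinite := by
  intro hfin
  obtain ⟨w₀, hw₀⟩ := exists_isLongest cs univ
  have hdesc : cs.IsLeftDescent w₀ j' := hw₀.isLeftDescent (mem_univ j')
  obtain ⟨e, hxe⟩ := exists_δ_eq (D := D) x (cs.simple j * (cs.simple i * w))
  obtain ⟨e', hee', -, hxe'⟩ := exists_δ_right hxe j'
  obtain ⟨m, hem, hme, hme'⟩ := exists_adj_ne_ne (D := D) j' e e'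
  have hxm : D.δ x m = cs.simple j * (cs.simple i * w) := by
    refine δ_right_eq_simple_mul_simple_mul_of_rankTwo h.symm ?_ (hee'.symm.trans hem) hme'
    simp only [hxe', h.snd_mul, mul_assoc]
  obtain ⟨k, hmk⟩ := exists_δ_eq (D := D) m (cs.simple j' * w₀)
  have hek : D.δ e k = w₀ := δ_left_eq_of_ne hdesc hmk hem.symm hme.symm
  let T : Set C := {a | ∃ b, (D.Adj j' a b ∧ cs.length (D.δ b k) < cs.length w₀) ∧
    D.IsNear j i' (cs.length (cs.simple i * w)) x b}
  have heT : e ∉ T := by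
    rintro ⟨b, ⟨heb, hlt⟩, hb⟩
    obtain rfl := eq_of_length_δ_left_lt hdesc hmk (hem.symm.trans heb) hlt
    exact not_isNear_of_δ_eq h hxm hb
  have hT (a : C) (hea : D.Adj i' e a) (hae : a ≠ e) (hak : D.δ a k = w₀) : a ∈ T := by
    obtain ⟨b, hab, hba, hbk⟩ := exists_δ_left hak j'
    have hxa := δ_right_eq_simple_mul_of_rankTwo h hxe hea hae
    have hxb := δ_right_eq_of_rankTwo h.symm hxa hab hba
    exact ⟨b, ⟨hab, hbk ▸ hdesc⟩, isNear_of_δ_eq h hxb⟩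
  obtain ⟨S, -, heS, hcl⟩ := hD.isCountableAccPt_of_rankTwo h hi e
  have hopen : IsOpen {a : D.panel i' e | a.1 ∈ Tᶜ ∩ {a | D.δ a k = w₀}} :=
    ((hD.isClosed_isNear_proj hfin k).isOpen_compl.inter
      (hD.isOpen_δ_eq hw₀ continuous_id continuous_const)).preimage continuous_subtype_val
  obtain ⟨a, ⟨haT, hak⟩, haS⟩ := mem_closure_iff.mp hcl _ hopen ⟨heT, hek⟩
  refine haT (hT a a.2 (fun hae => heS ?_) hak)
  rwa [← show a = D.panelPoint i' e from Subtype.ext hae]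

theorem isCountableAccPt_of_infinite (hD : D.ClosedAdj) [Finite W] [Nontrivial B]
    (hirr : cs.IsIrreducible) (hinf : (D.panel i c).Infinite) (j : B) (d : C) :
    IsCountableAccPt (D.panelPoint j d) := by
  let J : Set B := {j | ∀ d, IsCountableAccPt (D.panelPoint j d)}
  have mem_J {i : B} {c : C} (h : (D.panel i c).Infinite) : i ∈ J := by
    obtain ⟨c', hc'⟩ := hD.exists_isCountableAccPt_panelPoint h
    exact fun d => (hD.perspectivityInvariant_isCountableAccPt.iff
      (exists_not_commute_of_isIrreducible hirr) i c' d).mp hc'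
  by_contra hj
  obtain ⟨a, ha, b, hb, hab⟩ := hirr J ⟨i, mem_J hinf⟩ ⟨j, fun h => hj (h d)⟩
  obtain ⟨i', j', w, h⟩ := exists_rankTwo hab
  exact hb (mem_J (hD.infinite_panel h ha d))

end ClosedAdj

end WeylDistance

namespace WeylDistance

open CoxeterGroup Set

variable {B W C : Type*} [Group W] {M : CoxeterMatrix B} {cs : CoxeterSystem M W}
  {D : WeylDistance cs C} {i j i' j' : B} {a b c d e f g s x x' y z z₀ : C} {w : W}

variable (D) in
/-- The fixed chambers of the family of perspectivities `IsFrameProj`, which detects the diagonal of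
the `i`-panel of `c` away from `c`. In a residue with longest element `w` they are chosen near the
chambers opposite to `c`, so that every `a ≠ c` in the `i`-panel of `c` is at distance `w` from `b`
and from `g`. -/
structure IsFrame (i j i' j' : B) (w : W) (c z₀ d b g : C) : Prop where
  rankTwo : RankTwo cs i j i' j' w
  δ_eq : D.δ c z₀ = cs.simple i * (cs.simple j * (cs.simple i * w))
  adj_d : D.Adj i' z₀ d
  d_ne : d ≠ z₀
  adj_b : D.Adj j' d b
  b_ne : b ≠ d
  adj_g : D.Adj j' d g
  g_ne : g ≠ d
  g_ne_b : g ≠ b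

variable (D) in
/-- The chambers `y`, `x`, `f`, `e` are obtained from `a` by successive projections: `b` projects to
`y` in the `j`-panel of `a`, `z` projects to `x` in the `i`-panel of `y`, and `x` projects to `f` in
the `i'`-panel of `g` and to `e` in the `j'`-panel of `f`. -/
def IsProjChain (i j i' j' : B) (w : W) (b g z a y x f e : C) : Prop :=
  (D.Adj j a y ∧ cs.length (D.δ y b) < cs.length w) ∧
  (D.Adj i y x ∧ cs.length (D.δ x z) < cs.length w) ∧
  (D.Adj i' g f ∧ cs.length (D.δ x f) < cs.length w) ∧
  (D.Adj j' f e ∧ cs.length (D.δ x e) < cs.length (cs.simple i * w))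

variable (D) in
/-- The chamber `s` is the double projection of `x'` with respect to the final chamber of a chain
of projections starting at `a`. Away from `c`, this defines a family with parameter `z` of
multi-valued functions `(a, x') ↦ s`, which are equal to `b` on the diagonal for `z ≠ z₀`, and equal
to `d` off the diagonal for `z = z₀`. -/
def IsFrameProj (i j i' j' : B) (w : W) (d b g z a x' s : C) : Prop :=
  ∃ y x f e, D.IsProjChain i j i' j' w b g z a y x f e ∧ D.IsDoubleProj j j' w d e x' s

namespace IsFrame

theorem exists_isFrame (h : RankTwo cs i j i' j' w) (c : C) :
    ∃ z₀ d b g, D.IsFrame i j i' j' w c z₀ d b g := by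
  obtain ⟨z₀, hz₀⟩ := exists_δ_eq (D := D) c (cs.simple i * (cs.simple j * (cs.simple i * w)))
  obtain ⟨d, hd, hdz, -⟩ := exists_adj_ne_ne (D := D) i' z₀ z₀
  obtain ⟨b, hb, hbd, -⟩ := exists_adj_ne_ne (D := D) j' d d
  obtain ⟨g, hg, hgd, hgb⟩ := exists_adj_ne_ne (D := D) j' d b
  exact ⟨z₀, d, b, g, h, hz₀, hd, hdz, hb, hbd, hg, hgd, hgb⟩

theorem δ_d (hF : D.IsFrame i j i' j' w c z₀ d b g) (ha : D.Adj i c a) (hac : a ≠ c) :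
    D.δ a d = cs.simple j * w :=
  δ_left_eq_of_ne hF.rankTwo.isLeftDescent_simple_mul
    (δ_right_eq_simple_mul_simple_mul_of_rankTwo hF.rankTwo hF.δ_eq hF.adj_d hF.d_ne) ha hac

theorem δ_b (hF : D.IsFrame i j i' j' w c z₀ d b g) (ha : D.Adj i c a) (hac : a ≠ c) :
    D.δ a b = w :=
  δ_right_eq_of_rankTwo hF.rankTwo.symm (hF.δ_d ha hac) hF.adj_b hF.b_ne

theorem δ_g (hF : D.IsFrame i j i' j' w c z₀ d b g) (ha : D.Adj i c a) (hac : a ≠ c) :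
    D.δ a g = w :=
  δ_right_eq_of_rankTwo hF.rankTwo.symm (hF.δ_d ha hac) hF.adj_g hF.g_ne

theorem δ_z₀_of_adj (hF : D.IsFrame i j i' j' w c z₀ d b g) (ha : D.Adj i c a) (hac : a ≠ c)
    (hy : D.Adj j a y) (hya : y ≠ a) : D.δ y z₀ = cs.simple i * w :=
  δ_left_eq_of_ne hF.rankTwo.symm.isLeftDescent_simple_mul
    (δ_left_eq_of_ne hF.rankTwo.symm.isLeftDescent_simple_mul_simple_mul hF.δ_eq ha hac) hy hya

theorem δ_g_of_δ_b (hF : D.IsFrame i j i' j' w c z₀ d b g) (hyb : D.δ y b = cs.simple j * w) :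
    D.δ y g = w :=
  δ_right_eq_of_rankTwo hF.rankTwo.symm hyb (hF.adj_b.symm.trans hF.adj_g) hF.g_ne_b

theorem δ_g_of_δ_z (hF : D.IsFrame i j i' j' w c z₀ d b g) (hyg : D.δ y g = w)
    (hz : D.Adj i' z₀ z) (hzd : z ≠ d) (hx : D.Adj i y x) (hxz : D.δ x z = cs.simple i * w) :
    D.δ x g = w := by
  have h := hF.rankTwo
  have hxd : D.δ x d = w := δ_right_eq_of_rankTwo h hxz (hz.symm.trans hF.adj_d) hzd.symm
  rcases δ_left_cases (Or.inl hyg) hx with hxg | hxg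
  · exact hxg
  refine (δ_right_cases (Or.inl hxd) hF.adj_g).resolve_right fun hxg' => h.simple_ne ?_
  rw [← h.snd_mul, hxg] at hxg'
  exact mul_right_cancel hxg'

theorem isProjChain_δ_b (hF : D.IsFrame i j i' j' w c z₀ d b g) (ha : D.Adj i c a) (hac : a ≠ c)
    (hch : D.IsProjChain i j i' j' w b g z a y x f e) : D.δ y b = cs.simple j * w :=
  δ_left_eq_of_length_lt (Or.inl (hF.δ_b ha hac)) hch.1.1 hch.1.2

theorem isProjChain_ne (hF : D.IsFrame i j i' j' w c z₀ d b g) (ha : D.Adj i c a) (hac : a ≠ c)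
    (hch : D.IsProjChain i j i' j' w b g z a y x f e) : y ≠ a := by
  rintro rfl
  exact hch.1.2.ne (congrArg cs.length (hF.δ_b ha hac))

theorem isProjChain_eq (hF : D.IsFrame i j i' j' w c z₀ d b g) (ha : D.Adj i c a) (hac : a ≠ c)
    (hch : D.IsProjChain i j i' j' w b g z₀ a y x f e) : x = y :=
  eq_of_length_δ_left_lt hF.rankTwo.isLeftDescent
    (hF.δ_z₀_of_adj ha hac hch.1.1 (hF.isProjChain_ne ha hac hch)) hch.2.1.1 hch.2.1.2

theorem isProjChain_δ_z (hF : D.IsFrame i j i' j' w c z₀ d b g) (ha : D.Adj i c a) (hac : a ≠ c)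
    (hz : D.Adj i' z₀ z) (hch : D.IsProjChain i j i' j' w b g z a y x f e) :
    D.δ x z = cs.simple i * w := by
  have hyz₀ := hF.δ_z₀_of_adj ha hac hch.1.1 (hF.isProjChain_ne ha hac hch)
  by_cases hzz₀ : z = z₀
  · subst hzz₀
    rw [hF.isProjChain_eq ha hac hch, hyz₀]
  · exact δ_left_eq_of_length_lt (Or.inl (δ_right_eq_of_rankTwo hF.rankTwo hyz₀ hz hzz₀))
      hch.2.1.1 hch.2.1.2

theorem isProjChain_ne' (hF : D.IsFrame i j i' j' w c z₀ d b g) (ha : D.Adj i c a) (hac : a ≠ c)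
    (hz : D.Adj i' z₀ z) (hzz₀ : z ≠ z₀) (hch : D.IsProjChain i j i' j' w b g z a y x f e) :
    y ≠ x := by
  rintro rfl
  have hyz₀ := hF.δ_z₀_of_adj ha hac hch.1.1 (hF.isProjChain_ne ha hac hch)
  exact hch.2.1.2.ne (congrArg cs.length (δ_right_eq_of_rankTwo hF.rankTwo hyz₀ hz hzz₀))

theorem isProjChain_δ_e (hF : D.IsFrame i j i' j' w c z₀ d b g) (ha : D.Adj i c a) (hac : a ≠ c)
    (hz : D.Adj i' z₀ z) (hzd : z ≠ d) (hch : D.IsProjChain i j i' j' w b g z a y x f e) :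
    D.δ x e = cs.simple i * (cs.simple j * w) := by
  have h := hF.rankTwo
  have hxg : D.δ x g = w := hF.δ_g_of_δ_z (hF.δ_g_of_δ_b (hF.isProjChain_δ_b ha hac hch)) hz hzd
    hch.2.1.1 (hF.isProjChain_δ_z ha hac hz hch)
  have hxf := δ_right_eq_of_length_lt (Or.inl hxg) hch.2.2.1.1 hch.2.2.1.2
  rw [← h.fst_mul] at hxf
  rw [δ_right_eq_of_length_lt (Or.inl hxf) hch.2.2.2.1 hch.2.2.2.2, mul_assoc, h.snd_mul]

theorem exists_isProjChain (hF : D.IsFrame i j i' j' w c z₀ d b g) (ha : D.Adj i c a)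
    (hac : a ≠ c) (hz : D.Adj i' z₀ z) (hzz₀ : z ≠ z₀) (hzd : z ≠ d) :
    ∃ y x f e, D.IsProjChain i j i' j' w b g z a y x f e := by
  have h := hF.rankTwo
  obtain ⟨y, hy, hya, hyb⟩ := exists_δ_left (hF.δ_b ha hac) j
  have hyz := δ_right_eq_of_rankTwo h (hF.δ_z₀_of_adj ha hac hy hya) hz hzz₀
  obtain ⟨x, hx, -, hxz⟩ := exists_δ_left hyz i
  have hxg := hF.δ_g_of_δ_z (hF.δ_g_of_δ_b hyb) hz hzd hx hxz
  obtain ⟨f, hf, -, hxf⟩ := exists_δ_right_of_rankTwo h hxg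
  obtain ⟨e, he, -, hxe⟩ := exists_δ_right hxf j'
  exact ⟨y, x, f, e, ⟨hy, hyb ▸ h.symm.isLeftDescent⟩, ⟨hx, hxz ▸ h.isLeftDescent⟩,
    ⟨hf, hxf ▸ h.isLeftDescent⟩, he, hxe ▸ h.symm.isRightDescent_simple_mul⟩

theorem isFrameProj_off_diagonal (hF : D.IsFrame i j i' j' w c z₀ d b g) (ha : D.Adj i c a)
    (hac : a ≠ c) (hx' : D.Adj i c x') (hx'c : x' ≠ c) (hne : a ≠ x')
    (hs : D.IsFrameProj i j i' j' w d b g z₀ a x' s) : s = d := by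
  have h := hF.rankTwo
  obtain ⟨y, x, f, e, hch, y', hxy', hy'e, hds, hy's⟩ := hs
  have hye := hF.isProjChain_δ_e ha hac (Adj.refl i' z₀) hF.d_ne.symm hch
  rw [hF.isProjChain_eq ha hac hch] at hye
  have hae : D.δ a e = cs.simple i * (cs.simple j * w) := by
    refine (δ_left_cases (Or.inl hye) hch.1.1.symm).resolve_right fun hae => ?_
    have hge := length_δ_le_succ (D := D) (c := a) hch.2.2.2.1.symm
    have hgf := length_δ_le_succ (D := D) (c := a) hch.2.2.1.1.symm
    have hlt₁ : cs.length _ < cs.length _ := h.isLeftDescent_simple_mul_simple_mul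
    have hlt₂ : cs.length _ < cs.length _ := h.isLeftDescent_simple_mul
    have hlt₃ : cs.length _ < cs.length _ := h.symm.isLeftDescent
    rw [hae] at hge
    rw [hF.δ_g ha hac] at hgf
    omega
  have hx'e := δ_left_eq_of_ne h.isLeftDescent_simple_mul hae (ha.symm.trans hx') hne.symm
  obtain rfl := eq_of_length_δ_left_lt h.symm.isLeftDescent hx'e hxy' hy'e
  exact eq_of_length_δ_right_lt_of_rankTwo h.symm (hF.δ_d hx' hx'c) hds hy's

theorem isFrameProj_diagonal (hF : D.IsFrame i j i' j' w c z₀ d b g) (ha : D.Adj i c a)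
    (hac : a ≠ c) (hz : D.Adj i' z₀ z) (hzz₀ : z ≠ z₀) (hzd : z ≠ d)
    (hs : D.IsFrameProj i j i' j' w d b g z a a s) : s = b := by
  have h := hF.rankTwo
  obtain ⟨y, x, f, e, hch, y', hay', hy'e, hds, hy's⟩ := hs
  have hye := δ_left_eq_of_ne h.isLeftDescent_simple_mul (hF.isProjChain_δ_e ha hac hz hzd hch)
    hch.2.1.1.symm (hF.isProjChain_ne' ha hac hz hzz₀ hch)
  obtain rfl := eq_of_length_δ_left_lt h.symm.isLeftDescent hye (hch.1.1.symm.trans hay') hy'e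
  exact eq_of_length_δ_right_lt_of_rankTwo h.symm (hF.isProjChain_δ_b ha hac hch)
    (hF.adj_b.symm.trans hds) hy's

theorem exists_isFrameProj (hF : D.IsFrame i j i' j' w c z₀ d b g) (ha : D.Adj i c a)
    (hac : a ≠ c) (hx' : D.Adj i c x') (hx'c : x' ≠ c) (hz : D.Adj i' z₀ z) (hzz₀ : z ≠ z₀)
    (hzd : z ≠ d) : ∃ s, D.IsFrameProj i j i' j' w d b g z a x' s := by
  have h := hF.rankTwo
  obtain ⟨y, x, f, e, hch⟩ := hF.exists_isProjChain ha hac hz hzz₀ hzd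
  have hye := δ_left_eq_of_ne h.isLeftDescent_simple_mul (hF.isProjChain_δ_e ha hac hz hzd hch)
    hch.2.1.1.symm (hF.isProjChain_ne' ha hac hz hzz₀ hch)
  have hae := δ_left_eq_of_ne h.symm.isLeftDescent hye hch.1.1.symm
    (hF.isProjChain_ne ha hac hch).symm
  obtain ⟨y', hxy', hy'e⟩ : ∃ y', D.Adj j x' y' ∧ cs.length (D.δ y' e) < cs.length w := by
    rcases δ_left_cases (Or.inl hae) (ha.symm.trans hx') with hx'e | hx'e
    · exact (existsUnique_δ_left h.symm.isLeftDescent (Or.inl hx'e)).exists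
    · exact ⟨x', Adj.refl j x', hx'e ▸ h.isLeftDescent⟩
  have hy'd := (δ_left_cases (Or.inr (hF.δ_d hx' hx'c)) hxy').imp_right fun hy'd =>
    hy'd.trans h.snd_mul
  obtain ⟨s, hds, hy's⟩ := (existsUnique_δ_right h.symm.isRightDescent hy'd).exists
  exact ⟨s, y, x, f, e, hch, y', hxy', hy'e, hds, hy's⟩

end IsFrame

end WeylDistance

/-! ### Second countability -/

namespace WeylDistance

open CoxeterGroup Set Topology

variable {B W C : Type*} [Group W] {M : CoxeterMatrix B} {cs : CoxeterSystem M W}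
  {D : WeylDistance cs C} {i j i' j' : B} {b c d g o : C} {w w₀ : W}
  [TopologicalSpace C] [CompactSpace C]

namespace ClosedAdj

theorem isClosed_exists_adj (hD : D.ClosedAdj) {K : Set C} (hK : IsClosed K) (i : B) :
    IsClosed {z | ∃ c ∈ K, D.Adj i c z} :=
  isClosed_setOf_exists <| (hK.preimage continuous_snd).and <|
    hD.isClosed i continuous_snd continuous_fst

variable [T2Space C] [Finite B]

theorem isClosed_isFrameProj (hD : D.ClosedAdj) (i j i' j' : B) (w : W) (d b g : C) :
    IsClosed {q : (C × C × C) × C |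
      D.IsFrameProj i j i' j' w d b g q.1.1 q.1.2.1 q.1.2.2 q.2} := by
  refine isClosed_setOf_exists <| isClosed_setOf_exists <| isClosed_setOf_exists <|
    isClosed_setOf_exists <| IsClosed.and
      (.and (.and ?_ ?_) <| .and (.and ?_ ?_) <| .and (.and ?_ ?_) <| .and ?_ ?_)
      (hD.isClosed_isDoubleProj j j' w d (by fun_prop) (by fun_prop) (by fun_prop))
  all_goals
    first
    | exact hD.isClosed _ (by fun_prop) (by fun_prop)
    | exact hD.isClosed_length_lt _ (by fun_prop) (by fun_prop)

theorem secondCountableTopology_panel (hD : D.ClosedAdj) (h : RankTwo cs i j i' j' w)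
    (hi : ∀ c, IsCountableAccPt (D.panelPoint i c)) (c : C) :
    SecondCountableTopology (D.panel i c) := by
  have := hD.compactSpace_panel i c
  obtain ⟨c', hc', hne, -⟩ := exists_adj_ne_ne (D := D) i c c
  have : Nontrivial (D.panel i c) :=
    ⟨D.panelPoint i c, ⟨c', hc'⟩, fun h => hne (congrArg Subtype.val h).symm⟩
  refine secondCountableTopology_of_isGδ_diagonal_diff ?_
  rintro ⟨x₀, hx₀⟩
  obtain ⟨z₀, d, b, g, hF⟩ := IsFrame.exists_isFrame (D := D) h x₀
  obtain ⟨S, hS, hzS, hcl⟩ := hD.isCountableAccPt_of_rankTwo h hi z₀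
  have hz₀ : D.panelPoint i' z₀ ∈ closure (S \ {⟨d, hF.adj_d⟩}) := by
    rw [sdiff_eq, inter_comm]
    refine (isOpen_compl_singleton.inter_closure) ⟨?_, hcl⟩
    exact fun h => hF.d_ne (congrArg Subtype.val h).symm
  have adj (x : D.panel i c) : D.Adj i x₀ x := (Adj.symm hx₀).trans x.2
  have ne {x : D.panel i c} (hx : x ≠ ⟨x₀, hx₀⟩) : x.1 ≠ x₀ := fun h => hx (Subtype.ext h)
  have ne_z₀ {z : D.panel i' z₀} (hz : z ∈ S \ {⟨d, hF.adj_d⟩}) : z.1 ≠ z₀ := fun h =>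
    hzS ((Subtype.ext h : z = D.panelPoint i' z₀) ▸ hz.1)
  have ne_d {z : D.panel i' z₀} (hz : z ∈ S \ {⟨d, hF.adj_d⟩}) : z.1 ≠ d := fun h =>
    hz.2 (Subtype.ext h)
  refine isGδ_diagonal_diff_of_isClosed_rel
    (F := fun (z : D.panel i' z₀) (x x' : D.panel i c) s =>
      D.IsFrameProj i j i' j' w d b g z x x' s)
    ((hD.isClosed_isFrameProj i j i' j' w d b g).preimage
      (f := fun q : (D.panel i' z₀ × D.panel i c × D.panel i c) × C =>
        ((q.1.1.1, q.1.2.1.1, q.1.2.2.1), q.2)) (by fun_prop))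
    (hS.mono sdiff_subset) hz₀ hF.b_ne.symm (fun z hz x x' hx hx' => ?_)
    (fun z hz x s hx hs => ?_) (fun x x' s hx hx' hxx' hs => ?_)
  · exact hF.exists_isFrameProj (adj x) (ne hx) (adj x') (ne hx') z.2 (ne_z₀ hz) (ne_d hz)
  · exact hF.isFrameProj_diagonal (adj x) (ne hx) z.2 (ne_z₀ hz) (ne_d hz) hs
  · exact hF.isFrameProj_off_diagonal (adj x) (ne hx) (adj x') (ne hx')
      (fun h => hxx' (Subtype.ext h)) hs

theorem secondCountableTopology_exists_adj_of_δ_eq (hD : D.ClosedAdj)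
    (hw₀ : IsLongest cs univ w₀) (hp : ∀ i c, SecondCountableTopology (D.panel i c)) {K : Set C}
    (hK : IsClosed K) [SecondCountableTopology K] (hKo : ∀ c ∈ K, D.δ c o = w₀) (i : B) :
    SecondCountableTopology {z | ∃ c ∈ K, D.Adj i c z} := by
  obtain ⟨k, -, hk⟩ := hw₀.exists_simple_mul_eq_mul_simple (mem_univ i)
  have hleft : cs.IsLeftDescent w₀ i := hw₀.isLeftDescent (mem_univ i)
  have hright : cs.IsRightDescent w₀ k := by rwa [CoxeterSystem.IsRightDescent, ← hk]
  have := isCompact_iff_compactSpace.mp hK.isCompact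
  have := hD.compactSpace_panel k o
  let R : K × D.panel k o → C → Prop := fun p z =>
    D.Adj i p.1 z ∧ cs.length (D.δ z p.2) < cs.length w₀
  have hR : IsClosed {p : (K × D.panel k o) × C | R p.1 p.2} :=
    (hD.isClosed i (by fun_prop) (by fun_prop)).and
      (hD.isClosed_length_lt _ (by fun_prop) (by fun_prop))
  have huniq (p : K × D.panel k o) : ∃! z, R p z := by
    refine existsUnique_δ_left hleft ?_
    rw [hk]
    exact δ_right_cases (Or.inl (hKo p.1 p.1.2)) p.2.2
  suffices heq : {z | ∃ c ∈ K, D.Adj i c z} = {z | ∃ p, R p z} from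
    heq ▸ secondCountableTopology_setOf_exists_rel hR huniq
  ext z
  constructor
  · rintro ⟨c, hc, hcz⟩
    have hzo := δ_left_cases (Or.inl (hKo c hc)) hcz
    rw [hk] at hzo
    obtain ⟨y, hy, hlt⟩ := (existsUnique_δ_right hright hzo).exists
    exact ⟨(⟨c, hc⟩, ⟨y, hy⟩), hcz, hlt⟩
  · rintro ⟨p, hpz, -⟩
    exact ⟨p.1, p.1.2, hpz⟩

theorem secondCountableTopology_exists_adj (hD : D.ClosedAdj) [Finite W]
    (hp : ∀ i c, SecondCountableTopology (D.panel i c)) {K : Set C} (hK : IsClosed K)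
    [SecondCountableTopology K] (i : B) : SecondCountableTopology {z | ∃ c ∈ K, D.Adj i c z} := by
  obtain ⟨w₀, hw₀⟩ := exists_isLongest cs univ
  choose o ho using fun c : C => exists_δ_eq (D := D) c w₀
  choose F hF hFcl hFo using fun c : C => exists_mem_nhds_isClosed_subset
    ((hD.isOpen_δ_eq hw₀ continuous_id continuous_const).mem_nhds (ho c))
  obtain ⟨t, -, ht⟩ := hK.isCompact.elim_nhds_subcover F fun c _ => hF c
  have hcover : {z | ∃ c ∈ K, D.Adj i c z} = ⋃ x : t, {z | ∃ c ∈ K ∩ F x, D.Adj i c z} := by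
    ext z
    simp only [mem_ofPred_eq, mem_iUnion]
    constructor
    · rintro ⟨c, hc, hcz⟩
      obtain ⟨x, hx, hcx⟩ := mem_iUnion₂.mp (ht hc)
      exact ⟨⟨x, hx⟩, c, ⟨hc, hcx⟩, hcz⟩
    · rintro ⟨x, c, hc, hcz⟩
      exact ⟨c, hc.1, hcz⟩
  rw [hcover]
  have hKF (x : t) : IsClosed (K ∩ F x) := hK.inter (hFcl x)
  refine secondCountableTopology_iUnion
    (fun x => (hD.isClosed_exists_adj (hKF x) i).isCompact) fun x => ?_
  have : SecondCountableTopology (K ∩ F x : Set C) :=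
    (IsEmbedding.inclusion inter_subset_left).secondCountableTopology
  exact hD.secondCountableTopology_exists_adj_of_δ_eq hw₀ hp (hKF x) (fun c hc => hFo x hc.2) i

theorem secondCountableTopology_of_panels (hD : D.ClosedAdj) [Finite W]
    (hp : ∀ i c, SecondCountableTopology (D.panel i c)) : SecondCountableTopology C := by
  rcases isEmpty_or_nonempty C with hC | ⟨⟨c⟩⟩
  · infer_instance
  have hball (n : ℕ) : SecondCountableTopology (D.ball c n) := by
    induction n with
    | zero =>
      have : Subsingleton (D.ball c 0) :=
        ⟨fun x y => Subtype.ext ((mem_ball_zero.mp x.2).symm.trans (mem_ball_zero.mp y.2))⟩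
      infer_instance
    | succ n ih =>
      have hcl : IsClosed (D.ball c n) := hD.isClosed_mem_ball n continuous_const continuous_id
      let K : Option B → Set C :=
        fun o => o.elim (D.ball c n) fun i => {z | ∃ x ∈ D.ball c n, D.Adj i x z}
      have hball_succ : D.ball c (n + 1) = ⋃ o, K o := by
        ext d
        simp only [iUnion_option, mem_union, mem_iUnion, mem_ball_succ, K, Option.elim,
          mem_ofPred_eq]
      rw [hball_succ]
      refine secondCountableTopology_iUnion (fun o => ?_) fun o => ?_
      · cases o with
        | none => exact hcl.isCompact
        | some i => exact (hD.isClosed_exists_adj hcl i).isCompact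
      · cases o with
        | none => exact ih
        | some i => exact hD.secondCountableTopology_exists_adj hp hcl i
  obtain ⟨n, hn⟩ := D.exists_ball_eq_univ c
  have : SecondCountableTopology (univ : Set C) := hn ▸ hball n
  exact (Homeomorph.Set.univ C).symm.isEmbedding.secondCountableTopology

theorem nonempty_homeomorph_cantorSet (hD : D.ClosedAdj) [Finite W] [Nontrivial B]
    (hirr : cs.IsIrreducible) [TotallyDisconnectedSpace C] [Infinite C] :
    Nonempty (C ≃ₜ cantorSet) := by
  obtain ⟨i, c, hic⟩ : ∃ i c, (D.panel i c).Infinite := by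
    by_contra! h
    have := finite_of_panels h
    exact not_finite C
  have hacc (j : B) (d : C) := hD.isCountableAccPt_of_infinite hirr hic j d
  have : SecondCountableTopology C := hD.secondCountableTopology_of_panels fun i c => by
    obtain ⟨j, hij⟩ := exists_not_commute_of_isIrreducible hirr i
    obtain ⟨i', j', w, h⟩ := exists_rankTwo hij
    exact hD.secondCountableTopology_panel h (hacc i) c
  have hperf (x : C) (hx : IsOpen {x}) : False := by
    obtain ⟨S, -, hxS, hcl⟩ := hacc i x
    obtain ⟨y, hyx, hy⟩ := mem_closure_iff.mp hcl _ (hx.preimage continuous_subtype_val) rfl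
    exact hxS ((Subtype.ext hyx : y = D.panelPoint i x) ▸ hy)
  obtain ⟨A, hA⟩ := exists_isClopenScheme hperf
  obtain ⟨e⟩ := hA.nonempty_homeomorph
  exact ⟨e.symm.trans cantorSetHomeomorphNatToBool.symm⟩

end ClosedAdj

end WeylDistance

/-! ### The Weyl distance of a building -/

namespace CoxeterGroup

open CoxeterSystem

variable {B W : Type*} [Group W] {M : CoxeterMatrix B} (cs : CoxeterSystem M W)

theorem parabolic_empty : cs.parabolic ∅ = ⊥ := by
  simp [parabolic]

theorem mem_parabolic_singleton_iff {i : B} {w : W} :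
    w ∈ cs.parabolic {i} ↔ w = 1 ∨ w = cs.simple i := by
  rw [parabolic, Set.image_singleton, Subgroup.mem_closure_singleton]
  constructor
  · rintro ⟨n, rfl⟩
    obtain ⟨k, rfl | rfl⟩ := n.even_or_odd'
    · exact Or.inl (by rw [zpow_mul, zpow_ofNat, cs.simple_sq, one_zpow])
    · exact Or.inr (by rw [zpow_add_one, zpow_mul, zpow_ofNat, cs.simple_sq, one_zpow, one_mul])
  · rintro (rfl | rfl)
    · exact ⟨0, zpow_zero _⟩
    · exact ⟨1, zpow_one _⟩

/-- The coset `w W_J`, as a simplex of the Coxeter complex. -/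
def coset (w : W) (J : Set B) : cs.CoxeterComplex :=
  ⟨w • (cs.parabolic J : Set W), w, J, rfl⟩

theorem mem_coset_iff {w x : W} {J : Set B} : x ∈ (coset cs w J).1 ↔ w⁻¹ * x ∈ cs.parabolic J :=
  mem_leftCoset_iff w

theorem coset_empty (w : W) : (coset cs w ∅).1 = {w} := by
  ext x
  rw [mem_coset_iff, parabolic_empty, Subgroup.mem_bot, Set.mem_singleton_iff, inv_mul_eq_one,
    eq_comm]

end CoxeterGroup

namespace ThickBuilding

open CoxeterGroup Set

variable {B W V : Type*} [Group W] {M : CoxeterMatrix B} {cs : CoxeterSystem M W}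

/-- A type preserving isomorphism of the apartment `A` with the Coxeter complex, which gives
coordinates in `W` to the chambers of `A`. -/
structure Chart (Δ : ThickBuilding cs V) (A : Set (Finset V)) where
  mem_apartments : A ∈ Δ.apartments
  toEquiv : A ≃ cs.CoxeterComplex
  subset_iff : ∀ a b : A, a.1 ⊆ b.1 ↔ (toEquiv b).1 ⊆ (toEquiv a).1
  typ_eq : ∀ (a : A) (w : W) (J : Set B),
    (toEquiv a).1 = w • (cs.parabolic J : Set W) → Δ.typ '' (a.1 : Set V) = Jᶜ

variable {Δ : ThickBuilding cs V} {A A' : Set (Finset V)} {a b c d x y : Finset V} {v w w' : W}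
  {i : B}

theorem exists_chart (ha : a ∈ Δ.simplices) (hb : b ∈ Δ.simplices) :
    ∃ A, ∃ _ : Δ.Chart A, a ∈ A ∧ b ∈ A := by
  obtain ⟨A, hA, haA, hbA⟩ := Δ.exists_apartment a ha b hb
  obtain ⟨e, hsubset, htyp⟩ := Δ.apartment_iso A hA
  exact ⟨A, ⟨hA, e, hsubset, htyp⟩, haA, hbA⟩

namespace Chart

variable (κ : Δ.Chart A)

/-- The simplex of the apartment which corresponds to the coset `w W_J`, that is, the face of type
`Jᶜ` of the chamber with coordinate `w`. -/
def face (w : W) (J : Set B) : Finset V := (κ.toEquiv.symm (coset cs w J)).1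

/-- The chamber of the apartment with coordinate `w`. -/
def chamber (w : W) : Finset V := κ.face w ∅

theorem face_mem (w : W) (J : Set B) : κ.face w J ∈ A := (κ.toEquiv.symm (coset cs w J)).2

theorem chamber_mem (w : W) : κ.chamber w ∈ A := κ.face_mem w ∅

theorem toEquiv_face (w : W) (J : Set B) :
    κ.toEquiv ⟨κ.face w J, κ.face_mem w J⟩ = coset cs w J :=
  κ.toEquiv.apply_symm_apply _

theorem subset_chamber_iff (ha : a ∈ A) : a ⊆ κ.chamber w ↔ w ∈ (κ.toEquiv ⟨a, ha⟩).1 := by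
  have hcoset : (κ.toEquiv ⟨κ.chamber w, κ.chamber_mem w⟩).1 = {w} :=
    (congrArg Subtype.val (κ.toEquiv_face w ∅)).trans (coset_empty cs w)
  rw [κ.subset_iff ⟨a, ha⟩ ⟨κ.chamber w, κ.chamber_mem w⟩, hcoset, singleton_subset_iff]

theorem mem_of_subset (h : a ⊆ κ.chamber w) : a ∈ A :=
  Δ.apartment_down_closed A κ.mem_apartments a _ h (κ.chamber_mem w)

theorem typ_face (w : W) (J : Set B) : Δ.typ '' (κ.face w J : Set V) = Jᶜ :=
  κ.typ_eq ⟨κ.face w J, κ.face_mem w J⟩ w J (by rw [κ.toEquiv_face]; rfl)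

theorem eq_face (h : a ⊆ κ.chamber w) : a = κ.face w (Δ.typ '' (a : Set V))ᶜ := by
  have ha := κ.mem_of_subset h
  rw [κ.subset_chamber_iff ha] at h
  obtain ⟨x, J, hJ⟩ := (κ.toEquiv ⟨a, ha⟩).2
  have hcoset : κ.toEquiv ⟨a, ha⟩ = coset cs w J := by
    refine Subtype.ext (hJ.trans ((leftCoset_eq_iff _).mpr ?_))
    rw [hJ] at h
    exact (mem_leftCoset_iff x).mp h
  rw [κ.typ_eq ⟨a, ha⟩ x J hJ, compl_compl, face, ← hcoset, Equiv.symm_apply_apply]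

theorem exists_subset_chamber (ha : a ∈ A) : ∃ w, a ⊆ κ.chamber w := by
  obtain ⟨x, J, hJ⟩ := (κ.toEquiv ⟨a, ha⟩).2
  refine ⟨x, (κ.subset_chamber_iff ha).mpr ?_⟩
  rw [hJ]
  exact mem_own_leftCoset (cs.parabolic J).toSubmonoid x

theorem face_subset_chamber_iff {J : Set B} :
    κ.face w J ⊆ κ.chamber w' ↔ w⁻¹ * w' ∈ cs.parabolic J := by
  rw [κ.subset_chamber_iff (κ.face_mem w J), κ.toEquiv_face, mem_coset_iff]

theorem typ_chamber (w : W) : Δ.typ '' (κ.chamber w : Set V) = univ := by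
  rw [chamber, typ_face, compl_empty]

theorem eq_chamber (ha : a ⊆ κ.chamber w) (h : Δ.typ '' (a : Set V) = univ) : a = κ.chamber w := by
  rw [κ.eq_face ha, h, compl_univ, chamber]

theorem chamber_injective : Function.Injective κ.chamber := by
  intro w w' h
  have hsubset : κ.face w ∅ ⊆ κ.chamber w' := h.subset
  rwa [face_subset_chamber_iff, parabolic_empty, Subgroup.mem_bot, inv_mul_eq_one] at hsubset

end Chart

theorem isChamber_iff : Δ.IsChamber c ↔ c ∈ Δ.simplices ∧ Δ.typ '' (c : Set V) = univ := by
  constructor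
  · intro hc
    obtain ⟨A, κ, hcA, -⟩ := exists_chart hc.prop hc.prop
    obtain ⟨w, hw⟩ := κ.exists_subset_chamber hcA
    have hcw : c = κ.chamber w :=
      hc.eq_of_le (Δ.apartment_subset A κ.mem_apartments (κ.chamber_mem w)) hw
    exact ⟨hc.prop, hcw ▸ κ.typ_chamber w⟩
  · rintro ⟨hc, htyp⟩
    refine ⟨hc, fun d hd hcd => ?_⟩
    obtain ⟨A, κ, hdA, -⟩ := exists_chart hd hd
    obtain ⟨w, hw⟩ := κ.exists_subset_chamber hdA
    rw [κ.eq_chamber (hcd.trans hw) htyp]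
    exact hw

theorem IsChamber.typ_eq (hc : Δ.IsChamber c) : Δ.typ '' (c : Set V) = univ :=
  (isChamber_iff.mp hc).2

/-- Two chambers are `i`-adjacent if they have a common face of type `{i}ᶜ`. -/
def Adj (Δ : ThickBuilding cs V) (i : B) (c d : Finset V) : Prop :=
  ∃ a : Finset V, Δ.typ '' (a : Set V) = {i}ᶜ ∧ a ⊆ c ∧ a ⊆ d

namespace Chart

variable (κ : Δ.Chart A)

theorem isChamber (w : W) : Δ.IsChamber (κ.chamber w) :=
  isChamber_iff.mpr
    ⟨Δ.apartment_subset A κ.mem_apartments (κ.chamber_mem w), κ.typ_chamber w⟩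

theorem exists_chamber_eq (hc : Δ.IsChamber c) (h : c ∈ A) : ∃ w, κ.chamber w = c := by
  obtain ⟨w, hw⟩ := κ.exists_subset_chamber h
  exact ⟨w, (κ.eq_chamber hw hc.typ_eq).symm⟩

theorem adj_iff : Δ.Adj i (κ.chamber w) (κ.chamber w') ↔ w' = w ∨ w' = w * cs.simple i := by
  have hmem : w⁻¹ * w' ∈ cs.parabolic {i} ↔ w' = w ∨ w' = w * cs.simple i := by
    rw [mem_parabolic_singleton_iff, inv_mul_eq_iff_eq_mul, inv_mul_eq_iff_eq_mul, mul_one]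
  constructor
  · rintro ⟨a, hat, haw, haw'⟩
    rw [κ.eq_face haw, hat, compl_compl, κ.face_subset_chamber_iff] at haw'
    exact hmem.mp haw'
  · intro h
    refine ⟨κ.face w {i}, κ.typ_face w {i}, κ.face_subset_chamber_iff.mpr ?_,
      κ.face_subset_chamber_iff.mpr (hmem.mpr h)⟩
    rw [inv_mul_cancel]
    exact one_mem _

theorem exists_chamber_eq_chamber_mul (κ κ' : Δ.Chart A) :
    ∃ g, ∀ w, κ'.chamber w = κ.chamber (g * w) := by
  choose σ hσ using fun w => κ.exists_chamber_eq (κ'.isChamber w) (κ'.chamber_mem w)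
  refine ⟨σ 1, fun w => ?_⟩
  rw [← hσ w]
  congr 1
  induction w using cs.simple_induction_right with
  | one => rw [mul_one]
  | mul_simple_right w i ih =>
    have hadj : Δ.Adj i (κ'.chamber w) (κ'.chamber (w * cs.simple i)) := κ'.adj_iff.mpr (Or.inr rfl)
    rw [← hσ, ← hσ, κ.adj_iff] at hadj
    rcases hadj with heq | heq
    · have hw : w * cs.simple i = w := κ'.chamber_injective (by rw [← hσ, ← hσ, heq])
      have hlength := cs.length_simple i
      rw [mul_eq_left.mp hw, cs.length_one] at hlength
      exact absurd hlength zero_ne_one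
    · rw [heq, ih, mul_assoc]

theorem exists_chart_of_mem (κ : Δ.Chart A) (hA' : A' ∈ Δ.apartments) (ha : a ∈ A) (hb : b ∈ A)
    (ha' : a ∈ A') (hb' : b ∈ A') : ∃ κ' : Δ.Chart A', ∀ w,
      (a ⊆ κ.chamber w → a ⊆ κ'.chamber w) ∧ (b ⊆ κ.chamber w → b ⊆ κ'.chamber w) := by
  obtain ⟨E, hsubset, htyp, hEa, hEb⟩ := Δ.exists_iso A κ.mem_apartments A' hA' a b ha hb ha' hb'
  let κ' : Δ.Chart A' :=
    { mem_apartments := hA'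
      toEquiv := E.symm.trans κ.toEquiv
      subset_iff := fun x y => by
        rw [Equiv.trans_apply, Equiv.trans_apply, ← κ.subset_iff, hsubset, E.apply_symm_apply,
          E.apply_symm_apply]
      typ_eq := fun x w J h => by
        rw [← κ.typ_eq _ w J h, ← htyp, E.apply_symm_apply] }
  have hfixed (w : W) (x : Finset V) (hx : x ∈ A) (hE : (E ⟨x, hx⟩).1 = x)
      (h : x ⊆ κ.chamber w) : x ⊆ κ'.chamber w := by
    have himage : (E ⟨x, hx⟩).1 ⊆ κ'.chamber w :=
      (hsubset ⟨x, hx⟩ ⟨κ.chamber w, κ.chamber_mem w⟩).mp h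
    rwa [hE] at himage
  exact ⟨κ', fun w => ⟨hfixed w a ha (hEa _ rfl), hfixed w b hb (hEb _ rfl)⟩⟩

theorem exists_subset_chamber_mul (κ : Δ.Chart A) (κ' : Δ.Chart A')
    (hw : κ.chamber w = κ'.chamber w') (ha : a ∈ A) (hv : a ⊆ κ'.chamber v) :
    ∃ g, w = g * w' ∧ a ⊆ κ.chamber (g * v) := by
  obtain ⟨κ'', h⟩ := κ'.exists_chart_of_mem κ.mem_apartments (κ'.chamber_mem w')
    (κ'.mem_of_subset hv) (hw ▸ κ.chamber_mem w) ha
  obtain ⟨g, hg⟩ := κ.exists_chamber_eq_chamber_mul κ''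
  refine ⟨g, κ.chamber_injective ?_, hg v ▸ (h v).2 hv⟩
  rw [← hg w', hw]
  exact κ''.eq_chamber ((h w').1 subset_rfl) (κ'.typ_chamber w')

end Chart

theorem IsChamber.exists_chart (hc : Δ.IsChamber c) (hd : Δ.IsChamber d) :
    ∃ A, ∃ κ : Δ.Chart A, ∃ w w', κ.chamber w = c ∧ κ.chamber w' = d := by
  obtain ⟨A, κ, hcA, hdA⟩ := ThickBuilding.exists_chart hc.prop hd.prop
  obtain ⟨w, hw⟩ := κ.exists_chamber_eq hc hcA
  obtain ⟨w', hw'⟩ := κ.exists_chamber_eq hd hdA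
  exact ⟨A, κ, w, w', hw, hw'⟩

theorem IsChamber.typ_injOn (hc : Δ.IsChamber c) : InjOn Δ.typ (c : Set V) := by
  obtain ⟨A, κ, w, -, rfl, -⟩ := hc.exists_chart hc
  intro u hu v hv h
  have hu' : {u} ⊆ κ.chamber w := Finset.singleton_subset_iff.mpr hu
  have hv' : {v} ⊆ κ.chamber w := Finset.singleton_subset_iff.mpr hv
  refine Finset.singleton_injective ?_
  rw [κ.eq_face hu', κ.eq_face hv', Finset.coe_singleton, Finset.coe_singleton, image_singleton,
    image_singleton, h]

theorem exists_weylDist (Δ : ThickBuilding cs V) : ∃ δ : Finset V → Finset V → W,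
    ∀ A, ∀ κ : Δ.Chart A, ∀ w w', δ (κ.chamber w) (κ.chamber w') = w⁻¹ * w' := by
  have h (c d : Finset V) : ∃ g : W, ∀ A, ∀ κ : Δ.Chart A, ∀ w w',
      κ.chamber w = c → κ.chamber w' = d → g = w⁻¹ * w' := by
    by_cases hcd : ∃ A, ∃ κ : Δ.Chart A, ∃ w w', κ.chamber w = c ∧ κ.chamber w' = d
    · obtain ⟨A, κ, w, w', rfl, rfl⟩ := hcd
      refine ⟨w⁻¹ * w', fun A' κ' u u' hu hu' => ?_⟩
      obtain ⟨g, rfl, hsubset⟩ := κ.exists_subset_chamber_mul κ' hu.symm (κ.chamber_mem w')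
        hu'.symm.subset
      rw [κ.chamber_injective (κ.eq_chamber hsubset (κ.typ_chamber w'))]
      group
    · exact ⟨1, fun A κ w w' hw hw' => (hcd ⟨A, κ, w, w', hw, hw'⟩).elim⟩
  choose δ hδ using h
  exact ⟨δ, fun A κ w w' => hδ _ _ A κ w w' rfl rfl⟩

/-- The Weyl distance `w⁻¹ w'` of the chambers with coordinates `w` and `w'` in an apartment. It is
only meaningful on pairs of chambers. -/
noncomputable def weylDist (Δ : ThickBuilding cs V) : Finset V → Finset V → W :=
  Δ.exists_weylDist.choose

theorem weylDist_chamber (κ : Δ.Chart A) (w w' : W) :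
    Δ.weylDist (κ.chamber w) (κ.chamber w') = w⁻¹ * w' :=
  Δ.exists_weylDist.choose_spec A κ w w'

namespace IsChamber

theorem weylDist_eq_one_iff (hc : Δ.IsChamber c) (hd : Δ.IsChamber d) :
    Δ.weylDist c d = 1 ↔ c = d := by
  obtain ⟨A, κ, w, w', rfl, rfl⟩ := hc.exists_chart hd
  rw [weylDist_chamber, inv_mul_eq_one, κ.chamber_injective.eq_iff]

theorem weylDist_inv (hc : Δ.IsChamber c) (hd : Δ.IsChamber d) :
    Δ.weylDist d c = (Δ.weylDist c d)⁻¹ := by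
  obtain ⟨A, κ, w, w', rfl, rfl⟩ := hc.exists_chart hd
  rw [weylDist_chamber, weylDist_chamber, mul_inv_rev, inv_inv]

theorem adj_iff (hc : Δ.IsChamber c) (hd : Δ.IsChamber d) :
    Δ.Adj i c d ↔ c = d ∨ Δ.weylDist c d = cs.simple i := by
  obtain ⟨A, κ, w, w', rfl, rfl⟩ := hc.exists_chart hd
  rw [κ.adj_iff, weylDist_chamber, κ.chamber_injective.eq_iff, inv_mul_eq_iff_eq_mul, eq_comm]

theorem exists_weylDist_eq_mul (hc : Δ.IsChamber c) (hd : Δ.IsChamber d) (i : B) :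
    ∃ e, Δ.IsChamber e ∧ Δ.weylDist d e = cs.simple i ∧
      Δ.weylDist c e = Δ.weylDist c d * cs.simple i := by
  obtain ⟨A, κ, w, w', rfl, rfl⟩ := hc.exists_chart hd
  refine ⟨κ.chamber (w' * cs.simple i), κ.isChamber _, ?_, ?_⟩
  · rw [weylDist_chamber, inv_mul_cancel_left]
  · rw [weylDist_chamber, weylDist_chamber, mul_assoc]

theorem weylDist_eq_or_eq_mul_simple (hc : Δ.IsChamber c) (hx : Δ.IsChamber x)
    (hy : Δ.IsChamber y) (h : Δ.Adj i x y) :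
    Δ.weylDist c y = Δ.weylDist c x ∨ Δ.weylDist c y = Δ.weylDist c x * cs.simple i := by
  obtain ⟨a, hat, hax, hay⟩ := h
  obtain ⟨A, κ, w, v, rfl, rfl⟩ := hc.exists_chart hx
  obtain ⟨A', κ', w', v', hw, rfl⟩ := hc.exists_chart hy
  obtain ⟨g, rfl, hg⟩ := κ.exists_subset_chamber_mul κ' hw.symm (κ.mem_of_subset hax) hay
  have hadj : Δ.Adj i (κ.chamber v) (κ.chamber (g * v')) := ⟨a, hat, hax, hg⟩
  have hv' : w'⁻¹ * v' = (g * w')⁻¹ * (g * v') := by group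
  rw [weylDist_chamber, ← hw, weylDist_chamber, hv', mul_assoc, mul_right_inj, mul_right_inj]
  exact κ.adj_iff.mp hadj

theorem exists_weylDist_eq_weylDist_mul (hc : Δ.IsChamber c) (hx : Δ.IsChamber x)
    (hy : Δ.IsChamber y) : ∃ g, cs.length g ≤ cs.length (Δ.weylDist c y) ∧
      Δ.weylDist x y = Δ.weylDist x c * g := by
  induction hn : cs.length (Δ.weylDist c y) generalizing y with
  | zero =>
    rw [cs.length_eq_zero_iff, hc.weylDist_eq_one_iff hy] at hn
    exact ⟨1, by rw [cs.length_one], by rw [hn, mul_one]⟩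
  | succ n ih =>
    have hne : Δ.weylDist c y ≠ 1 := by
      rw [Ne, ← cs.length_eq_zero_iff, hn]
      exact n.succ_ne_zero
    obtain ⟨i, hi⟩ := cs.exists_rightDescent_of_ne_one hne
    obtain ⟨z, hz, hyz, hcz⟩ := hc.exists_weylDist_eq_mul hy i
    have hlength := cs.isRightDescent_iff.mp hi
    obtain ⟨g, hgn, hg⟩ := ih hz (by rw [hcz]; omega)
    have hzy : Δ.Adj i z y := (hz.adj_iff hy).mpr
      (Or.inr (by rw [hy.weylDist_inv hz, hyz, cs.inv_simple]))
    rcases hx.weylDist_eq_or_eq_mul_simple hz hy hzy with heq | heq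
    · exact ⟨g, by omega, heq.trans hg⟩
    · have hgi := cs.length_mul_simple g i
      exact ⟨g * cs.simple i, by omega, by rw [heq, hg, mul_assoc]⟩

theorem weylDist_eq_mul_simple_of_length_lt (hc : Δ.IsChamber c) (hx : Δ.IsChamber x)
    (hy : Δ.IsChamber y) (h : Δ.weylDist x y = cs.simple i)
    (hlt : cs.length (Δ.weylDist c x) < cs.length (Δ.weylDist c x * cs.simple i)) :
    Δ.weylDist c y = Δ.weylDist c x * cs.simple i := by
  have hxy : Δ.Adj i x y := (hx.adj_iff hy).mpr (Or.inr h)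
  refine (hc.weylDist_eq_or_eq_mul_simple hx hy hxy).resolve_left fun heq => ?_
  obtain ⟨g, hle, hg⟩ := hc.exists_weylDist_eq_weylDist_mul hx hy
  rw [h, hc.weylDist_inv hx, eq_inv_mul_iff_mul_eq] at hg
  rw [hg, ← heq] at hlt
  exact hlt.not_ge hle

theorem exists_face (hc : Δ.IsChamber c) (i : B) :
    ∃ a, a ⊆ c ∧ Δ.typ '' (a : Set V) = {i}ᶜ := by
  obtain ⟨A, κ, w, -, rfl, -⟩ := hc.exists_chart hc
  refine ⟨κ.face w {i}, κ.face_subset_chamber_iff.mpr ?_, κ.typ_face w {i}⟩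
  rw [inv_mul_cancel]
  exact one_mem _

theorem exists_ne_weylDist_eq_simple (hc : Δ.IsChamber c) (i : B) :
    ∃ x y, Δ.IsChamber x ∧ Δ.IsChamber y ∧ x ≠ y ∧
      Δ.weylDist c x = cs.simple i ∧ Δ.weylDist c y = cs.simple i := by
  obtain ⟨a, hac, hat⟩ := hc.exists_face i
  have hnotMax : ¬ Δ.IsChamber a := fun ha => by
    have hi : i ∈ ({i}ᶜ : Set B) := hat ▸ ha.typ_eq ▸ mem_univ i
    exact hi rfl
  set S : Set (Finset V) := {c | Δ.IsChamber c ∧ a ⊆ c}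
  have hthree : 3 ≤ S.encard := Δ.thick a (Δ.down_closed a c hac hc.prop) hnotMax
  have hnontrivial : (S \ {c}).Nontrivial := by
    rw [← encard_sdiff_singleton_add_one (show c ∈ S from ⟨hc, hac⟩),
      show (3 : ℕ∞) = 2 + 1 by norm_num, ENat.add_le_add_iff_right ENat.one_ne_top] at hthree
    exact one_lt_encard_iff_nontrivial.mp (lt_of_lt_of_le (by norm_num) hthree)
  have hdist (z : Finset V) (hz : z ∈ S \ {c}) : Δ.weylDist c z = cs.simple i :=
    ((hc.adj_iff hz.1.1).mp ⟨a, hat, hac, hz.1.2⟩).resolve_left fun h => hz.2 h.symm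
  obtain ⟨x, hx, y, hy, hxy⟩ := hnontrivial
  exact ⟨x, y, hx.1.1, hy.1.1, hxy, hdist x hx, hdist y hy⟩

end IsChamber

/-- The chamber with a given tuple of vertices. -/
noncomputable def toChamber (x : Δ.chamberSet) : Finset V := x.2.choose

theorem isChamber_toChamber (x : Δ.chamberSet) : Δ.IsChamber (toChamber x) := x.2.choose_spec.1

theorem coe_toChamber (x : Δ.chamberSet) :
    (toChamber x : Set V) = range fun i => (x.1 i).1 := x.2.choose_spec.2

theorem mem_toChamber_iff {x : Δ.chamberSet} {v : V} :
    v ∈ toChamber x ↔ v = (x.1 (Δ.typ v)).1 := by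
  rw [← Finset.mem_coe, coe_toChamber]
  constructor
  · rintro ⟨i, rfl⟩
    exact congrArg (fun j => (x.1 j).1) (x.1 i).2.symm
  · exact fun h => ⟨_, h.symm⟩

theorem toChamber_injective : Function.Injective (toChamber (Δ := Δ)) := by
  intro x y h
  refine Subtype.ext (funext fun i => Subtype.ext ?_)
  have hmem : (x.1 i).1 ∈ toChamber y := by
    rw [← h, ← Finset.mem_coe, coe_toChamber]
    exact mem_range_self i
  rw [mem_toChamber_iff] at hmem
  rw [hmem, (x.1 i).2]

theorem IsChamber.exists_toChamber_eq (hc : Δ.IsChamber c) :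
    ∃ x : Δ.chamberSet, toChamber x = c := by
  have hvertex (i : B) : ∃ v ∈ (c : Set V), Δ.typ v = i :=
    (hc.typ_eq ▸ mem_univ i : i ∈ Δ.typ '' (c : Set V))
  choose f hf hfi using hvertex
  have hrange : (c : Set V) = range f :=
    Subset.antisymm (fun v hv => ⟨Δ.typ v, hc.typ_injOn (hf _) hv (hfi _)⟩)
      (range_subset_iff.mpr hf)
  refine ⟨⟨fun i => ⟨f i, hfi i⟩, c, hc, hrange⟩, Finset.coe_injective ?_⟩
  exact (coe_toChamber _).trans hrange.symm

theorem adj_toChamber_iff {x y : Δ.chamberSet} :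
    Δ.Adj i (toChamber x) (toChamber y) ↔ ∀ j, j ≠ i → x.1 j = y.1 j := by
  classical
  constructor
  · rintro ⟨a, hat, hax, hay⟩ j hj
    obtain ⟨v, hv, rfl⟩ : j ∈ Δ.typ '' (a : Set V) := hat ▸ hj
    exact Subtype.ext ((mem_toChamber_iff.mp (hax hv)).symm.trans (mem_toChamber_iff.mp (hay hv)))
  · intro h
    refine ⟨{v ∈ toChamber x | Δ.typ v ≠ i}, ?_, Finset.filter_subset _ _, fun v hv => ?_⟩
    · ext j
      constructor
      · rintro ⟨v, hv, rfl⟩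
        exact (Finset.mem_filter.mp hv).2
      · intro hj
        obtain ⟨v, hv, rfl⟩ : j ∈ Δ.typ '' (toChamber x : Set V) :=
          (isChamber_toChamber x).typ_eq ▸ mem_univ j
        exact ⟨v, Finset.mem_filter.mpr ⟨hv, hj⟩, rfl⟩
    · obtain ⟨hvx, hvi⟩ := Finset.mem_filter.mp hv
      rw [mem_toChamber_iff] at hvx ⊢
      rwa [← h _ hvi]

/-- The Weyl distance on the set of chambers, a chamber being given by its tuple of vertices. -/
noncomputable def weylDistance (Δ : ThickBuilding cs V) : WeylDistance cs Δ.chamberSet where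
  δ x y := Δ.weylDist (toChamber x) (toChamber y)
  eq_one_iff x y := by
    rw [(isChamber_toChamber x).weylDist_eq_one_iff (isChamber_toChamber y),
      toChamber_injective.eq_iff]
  inv x y := (isChamber_toChamber x).weylDist_inv (isChamber_toChamber y)
  step c x y i h := (isChamber_toChamber c).weylDist_eq_or_eq_mul_simple (isChamber_toChamber x)
    (isChamber_toChamber y)
    (((isChamber_toChamber x).adj_iff (isChamber_toChamber y)).mpr (Or.inr h))
  step_up c x y _ h hlt := (isChamber_toChamber c).weylDist_eq_mul_simple_of_length_lt
    (isChamber_toChamber x) (isChamber_toChamber y) h hlt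
  exists_step c x i := by
    obtain ⟨e, he, hxe, hce⟩ :=
      (isChamber_toChamber c).exists_weylDist_eq_mul (isChamber_toChamber x) i
    obtain ⟨y, rfl⟩ := he.exists_toChamber_eq
    exact ⟨y, hxe, hce⟩
  thick x i := by
    obtain ⟨y, z, hy, hz, hne, hxy, hxz⟩ :=
      (isChamber_toChamber x).exists_ne_weylDist_eq_simple i
    obtain ⟨y, rfl⟩ := hy.exists_toChamber_eq
    obtain ⟨z, rfl⟩ := hz.exists_toChamber_eq
    exact ⟨y, z, ne_of_apply_ne _ hne, hxy, hxz⟩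

theorem adj_weylDistance_iff {x y : Δ.chamberSet} :
    Δ.weylDistance.Adj i x y ↔ ∀ j, j ≠ i → x.1 j = y.1 j := by
  rw [← adj_toChamber_iff, (isChamber_toChamber x).adj_iff (isChamber_toChamber y),
    toChamber_injective.eq_iff]
  rfl

theorem closedAdj_weylDistance (Δ : ThickBuilding cs V)
    [∀ i : B, TopologicalSpace (Δ.VertexOfType i)] [∀ i : B, T2Space (Δ.VertexOfType i)] :
    Δ.weylDistance.ClosedAdj := by
  intro i
  simp only [adj_weylDistance_iff, Set.ofPred_forall]
  exact isClosed_iInter fun j => isClosed_iInter fun _ => isClosed_eq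
    ((continuous_apply j).comp (continuous_subtype_val.comp continuous_fst))
    ((continuous_apply j).comp (continuous_subtype_val.comp continuous_snd))

theorem IsSpherical.finite (h : Δ.IsSpherical) : Finite W := by
  obtain ⟨A, κ, -⟩ := exists_chart Δ.empty_mem Δ.empty_mem
  have := (h A κ.mem_apartments).to_subtype
  exact Finite.of_injective (fun w => (⟨κ.chamber w, κ.chamber_mem w⟩ : A)) fun w w' hw =>
    κ.chamber_injective (congrArg Subtype.val hw)

theorem nontrivial_chamberSet (Δ : ThickBuilding cs V) [Nonempty B] : Nontrivial Δ.chamberSet := by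
  obtain ⟨A, κ, -⟩ := exists_chart Δ.empty_mem Δ.empty_mem
  obtain ⟨x, -⟩ := (κ.isChamber 1).exists_toChamber_eq
  obtain ⟨y, z, hyz, -⟩ := Δ.weylDistance.thick x (Classical.arbitrary B)
  exact ⟨y, z, hyz⟩

end ThickBuilding

theorem mainTheorem8 {B W V : Type*} [Fintype B] [Group W] {M : CoxeterMatrix B}
    (cs : CoxeterSystem M W) (Δ : ThickBuilding cs V)
    [∀ i : B, TopologicalSpace (Δ.VertexOfType i)]
    (hcompact : Δ.IsCompactSpherical) (hirr : cs.IsIrreducible) (hrank : 2 ≤ Fintype.card B) :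
    Xor (ConnectedSpace Δ.chamberSet) (TotallyDisconnectedSpace Δ.chamberSet) ∧
      (TotallyDisconnectedSpace Δ.chamberSet → Infinite Δ.chamberSet →
        Nonempty (Δ.chamberSet ≃ₜ cantorSet)) := by
  have := hcompact.compact
  have := hcompact.hausdorff
  have : CompactSpace Δ.chamberSet :=
    isCompact_iff_compactSpace.mp hcompact.isClosed_chamberSet.isCompact
  have : Finite W := hcompact.spherical.finite
  have : Nontrivial B := Fintype.one_lt_card_iff_nontrivial.mp hrank
  have : Nontrivial Δ.chamberSet := Δ.nontrivial_chamberSet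
  have hD : Δ.weylDistance.ClosedAdj := Δ.closedAdj_weylDistance
  have hexclusive : ConnectedSpace Δ.chamberSet → ¬ TotallyDisconnectedSpace Δ.chamberSet :=
    fun _ _ => not_subsingleton Δ.chamberSet
      subsingleton_of_preconnected_totallyDisconnected
  refine ⟨?_, fun _ _ => hD.nonempty_homeomorph_cantorSet hirr⟩
  rcases hD.preconnectedSpace_or_totallyDisconnectedSpace hirr with h | h
  · have hconnected : ConnectedSpace Δ.chamberSet := { toNonempty := inferInstance }
    exact Or.inl ⟨hconnected, hexclusive hconnected⟩
  · exact Or.inr ⟨h, fun hconnected => hexclusive hconnected h⟩
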